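/- Work in $\mathbb R^3$ with $\langle v\rangle=\sqrt{1+|v|^2}$, $\boldsymbol c_\alpha[\chi](v)=\int_{\mathbb R^3}|v-v_*|^{\alpha}\chi(v_*)\,dv_*$, and $\|g\|_{\mathbb H^s}^2=\int_{\mathbb R^3}|\widehat g(\xi)|^2|\xi|^{2s}\,d\xi+\|g\|_{L^2}^2$, where $\widehat g(\xi)=\int_{\mathbb R^3}e^{-ix\cdot\xi}g(x)\,dx$ (extended to $L^2$ as usual). Let $\alpha\in(-3,1]$, $s\in(0,1)$ and $\beta\in\mathbb R$. (1) Suppose $-\tfrac32<\alpha+2s<0$, $\ell>\tfrac32+\alpha+2s$ and $2|\alpha|+\beta+\ell>\tfrac32$ (the last condition holds automatically if $\beta\ge 0$). Then there is a constant $C>0$ depending only on $\alpha,s,\beta,\ell$ such that for all $\chi,\psi:\mathbb R^3\to\mathbb R$ for which the norms on the right-hand side are finite, the integral defining $\boldsymbol c_\alpha[\chi](v)$ converges absolutely for almost every $v$, the function $\boldsymbol c_\alpha[\chi]\psi^2$ is integrable, and $$\int_{\mathbb R^3}\boldsymbol c_\alpha[\chi]\,\psi^2\,dv\le C\,\big\|\langle\cdot\rangle^{|\alpha|+\beta+\ell}\chi\big\|_{L^2}\Big(\big\|\langle\cdot\rangle^{\frac{\alpha-\beta}2}\psi\big\|_{\mathbb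 H^s}^2+\big\|\langle\cdot\rangle^{\frac\alpha2}\psi\big\|_{L^2}^2\Big).$$ (2) Suppose $\alpha+2s>0$ and $|\alpha|+\beta\ge\alpha$ (which holds automatically if $\beta\ge0$). Then there is a constant $C>0$ depending only on $\alpha,s,\beta$ such that for all $\chi,\psi:\mathbb R^3\to\mathbb R$ for which the norms on the right-hand side are finite, the integral defining $\boldsymbol c_\alpha[\chi](v)$ converges absolutely for almost every $v$, the function $\boldsymbol c_\alpha[\chi]\psi^2$ is integrable, and $$\int_{\mathbb R^3}\boldsymbol c_\alpha[\chi]\,\psi^2\,dv\le C\,\big\|\langle\cdot\rangle^{|\alpha|+\beta}\chi\big\|_{L^1}\Big(\big\|\langle\cdot\rangle^{\frac{\alpha-\beta}2}\psi\big\|_{\mathbb H^s}^2+\big\|\langle\cdot\rangle^{\frac\alpha2}\psi\big\|_{L^2}^2\Big).$$ -/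

import Mathlib

open MeasureTheory
open scoped ENNReal FourierTransform

noncomputable section

/-- The Euclidean space of dimension three, with its Lebesgue measure `volume`. -/
abbrev E3 : Type := EuclideanSpace ℝ (Fin 3)

/-- The bracket `⟨v⟩ = √(1 + |v|²)`. -/
def bracket (v : E3) : ℝ := Real.sqrt (1 + ‖v‖ ^ 2)

/-- The convolution `c_α[f](v) = ∫ |v - w| ^ α f(w) dw`. -/
def cConv (α : ℝ) (f : E3 → ℝ) (v : E3) : ℝ := ∫ w, ‖v - w‖ ^ α * f w

/-- The Fourier transform on `L²` in the normalization `ĝ(ξ) = ∫ exp(-i x·ξ) g(x) dx`. Mathlib's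
transform `𝓕` (extended to `L²` by Plancherel) has the phase `exp(-2π i x·ξ)`, so that
`ĝ(ξ) = 𝓕 g (ξ / 2π)`. -/
def fourierL2 (g : Lp (α := E3) ℂ 2 volume) (ξ : E3) : ℂ :=
  (𝓕 g : Lp (α := E3) ℂ 2 volume) ((2 * Real.pi)⁻¹ • ξ)

open scoped Classical in
/-- The squared Sobolev norm `‖g‖²_{H^s} = ∫ |ĝ(ξ)|² |ξ|^{2s} dξ + ‖g‖²_{L²}`, with values in
`[0, ∞]`; it is `∞` if `g` is not in `L²`. -/
def sobolevNormSq (s : ℝ) (g : E3 → ℝ) : ℝ≥0∞ :=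
  if h : MemLp (fun v => (g v : ℂ)) 2 volume then
    (∫⁻ ξ : E3, ENNReal.ofReal (‖fourierL2 (h.toLp (fun v => (g v : ℂ))) ξ‖ ^ 2 * ‖ξ‖ ^ (2 * s)))
      + eLpNorm g 2 volume ^ 2
  else ⊤

end

/-!
Both estimates bound the double integral `∬ |v - w|^α |χ(w)| ψ(v)² dw dv`. For `α ≥ 0` this follows
from `|v - w| ≤ 2⟨v⟩⟨w⟩`. For `α < 0` put `F = ⟨·⟩^{|α|+β+ℓ}|χ|` (with `ℓ = 0` in the second part)
and `G = ⟨·⟩^{(α-β)/2}ψ`. The kernel is split into the regions `|v - w| ≤ 1`, `1 ≤ |v - w| ≤ ⟨v⟩/2`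
and `|v - w| ≥ ⟨v⟩/2` (`exists_kernel_le`). In the last two it is bounded by powers of brackets, and
what is needed of `χ` is a bound for `F` convolved with `⟨·⟩^{-q}`, where `q > 3/2` if `F ∈ L²` and
`q = 0` if `F ∈ L¹`; there only weighted `L²` norms of `ψ` enter.

The regularity of `ψ` is needed for `|v - w| ≤ 1`, where the weights at `v` and `w` are comparable
and the claim is
`∬_{|v - w| ≤ 1} |v - w|^{-a} F(w) G(v)² ≲ Φ ‖G‖²_{H^s}` for `0 < a < 3`, `a < κ + 2s`,
whenever `F` has mass at most `Φ r^κ` in each ball of radius `r ≤ 1`: `κ = 3/2` for `F ∈ L²`, by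
Cauchy–Schwarz, and `κ = 0` for `F ∈ L¹` (`exists_kernelForm_nearKernel_le`). Since the inequality
`a < κ + 2s` is strict, no sharp Sobolev or Hardy inequality is required; the bound
`‖G(· + h) - G‖²_{L²} ≲ |h|^{2s} ‖G‖²_{H^s}` is enough, and it follows from Plancherel's identity
and `|e^{ix} - 1| ≤ 2|x|^s` (`lintegral_translate_sub_sq_le`). Let `T(r)` be the integral of
`F(w) G(v)²` over `|v - w| ≤ r`. Replacing `G` by its translates and averaging over `|h| ≤ R` gives
(`kernelForm_ball_le`)
`T(r) ≤ 2 Φ r^κ R^{2s} ‖G‖² + 2 (r/R)³ T(R + r)`.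
With `r = c^{n+1}` and `R + r = c^n`, the numbers `b_n = c^{-na} T(c^n)` satisfy
`b_{n+1} ≤ C θ^n + b_n / 2` for `c` small, because `a < 3`, with `θ = c^{κ+2s-a} < 1`, and `∑ b_n`
dominates the integral with the singular kernel.
-/

/-! ### Finite Sobolev norm and the modulus of continuity in `L²` -/

theorem eLpNorm_two_sq {V : Type*} [NormedAddCommGroup V] (f : E3 → V) :
    eLpNorm f 2 volume ^ 2 = ∫⁻ v, ‖f v‖ₑ ^ 2 := by
  have := eLpNorm_nnreal_pow_eq_lintegral (f := f) (μ := volume) (p := 2) (by norm_num)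
  simpa using this

theorem norm_exp_I_mul_sub_one_le_rpow {s : ℝ} (hs0 : 0 < s) (hs1 : s < 1) (x : ℝ) :
    ‖Complex.exp (Complex.I * x) - 1‖ ≤ 2 * |x| ^ s := by
  rcases le_total |x| 1 with h | h
  · have h1 : |x| ≤ |x| ^ s := by
      simpa using Real.rpow_le_rpow_of_exponent_ge' (abs_nonneg x) h hs0.le hs1.le
    have h2 := Real.norm_exp_I_mul_ofReal_sub_one_le (x := x)
    rw [Real.norm_eq_abs] at h2
    linarith [abs_nonneg x]
  · have h1 : 1 ≤ |x| ^ s := Real.one_le_rpow h hs0.le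
    have h2 : ‖Complex.exp (Complex.I * x) - 1‖ ≤ 1 + 1 := by
      refine (norm_sub_le _ _).trans ?_
      rw [mul_comm, Complex.norm_exp_ofReal_mul_I, norm_one]
    linarith

/-- The Fourier symbol `e^{2πi⟨h,ξ⟩} - 1` of the difference operator `g ↦ g(· + h) - g`. -/
noncomputable def diffSymbol (h ξ : E3) : ℂ :=
  Complex.exp (Complex.I * ((2 * Real.pi * inner ℝ h ξ : ℝ) : ℂ)) - 1

theorem continuous_diffSymbol (h : E3) : Continuous (diffSymbol h) := by
  unfold diffSymbol; fun_prop

theorem norm_diffSymbol_le_two (h ξ : E3) : ‖diffSymbol h ξ‖ ≤ 2 := by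
  refine (norm_sub_le _ _).trans ?_
  rw [mul_comm, Complex.norm_exp_ofReal_mul_I, norm_one]
  norm_num

/-- The factor `2π` belongs to the frequency, as in the change of variables that relates `𝓕` to
`fourierL2`. -/
theorem norm_diffSymbol_le {s : ℝ} (hs0 : 0 < s) (hs1 : s < 1) (h ξ : E3) :
    ‖diffSymbol h ξ‖ ≤ 2 * (‖h‖ * ‖(2 * Real.pi) • ξ‖) ^ s := by
  refine (norm_exp_I_mul_sub_one_le_rpow hs0 hs1 _).trans ?_
  gcongr
  have : 2 * Real.pi * inner ℝ h ξ = inner ℝ h ((2 * Real.pi) • ξ) := by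
    rw [inner_smul_right]
  rw [this]
  exact abs_real_inner_le_norm _ _

open SchwartzMap in
theorem fourier_compSubConstCLM_sub (f : 𝓢(E3, ℂ)) (h ξ : E3) :
    𝓕 (compSubConstCLM ℂ (-h) f - f) ξ = diffSymbol h ξ * 𝓕 f ξ := by
  rw [sub_eq_add_neg, FourierTransform.fourier_add, FourierTransform.fourier_neg,
    ← sub_eq_add_neg, _root_.sub_apply, diffSymbol, sub_mul, one_mul]
  congr 1
  have h1 : ((compSubConstCLM ℂ (-h) f : 𝓢(E3, ℂ)) : E3 → ℂ) = (f : E3 → ℂ) ∘ (fun v => v + h) := by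
    ext v; simp
  rw [SchwartzMap.fourier_coe, SchwartzMap.fourier_coe, h1]
  have := congrFun (VectorFourier.fourierIntegral_comp_add_right Real.fourierChar volume
    (innerₗ E3) (f : E3 → ℂ) h) ξ
  calc 𝓕 ((f : E3 → ℂ) ∘ fun v => v + h) ξ
      = Real.fourierChar (inner ℝ h ξ) • 𝓕 (f : E3 → ℂ) ξ := this
    _ = _ := by
      rw [Circle.smul_def, Real.fourierChar_apply, smul_eq_mul]
      congr 2
      push_cast
      ring

open SchwartzMap in
/-- Plancherel's identity for the difference operator on Schwartz functions. -/
theorem eLpNorm_translate_sub_schwartz (f : 𝓢(E3, ℂ)) (h : E3) :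
    eLpNorm (fun v => f (v + h) - f v) 2 volume =
      eLpNorm (fun ξ => diffSymbol h ξ * 𝓕 f ξ) 2 volume := by
  set φ : 𝓢(E3, ℂ) := compSubConstCLM ℂ (-h) f - f with hφ
  have h1 : (fun v => f (v + h) - f v) = φ := by
    ext v; simp [hφ]
  have h2 : (fun ξ => diffSymbol h ξ * 𝓕 f ξ) = (𝓕 φ : 𝓢(E3, ℂ)) := by
    ext ξ; exact (fourier_compSubConstCLM_sub f h ξ).symm
  rw [h1, h2]
  have h3 := norm_fourier_toL2_eq φ
  rw [norm_toLp, norm_toLp] at h3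
  exact ((ENNReal.toReal_eq_toReal_iff' ((𝓕 φ).memLp 2 volume).eLpNorm_ne_top
    (φ.memLp 2 volume).eLpNorm_ne_top).1 h3).symm

theorem eLpNorm_coe_sub_schwartz (g : Lp (α := E3) ℂ 2 volume) (f : SchwartzMap E3 ℂ) :
    eLpNorm (fun v => g v - f v) 2 volume = ‖g - f.toLp 2 volume‖ₑ := by
  rw [Lp.enorm_def]
  refine eLpNorm_congr_ae ?_
  filter_upwards [Lp.coeFn_sub g (f.toLp 2 volume), f.coeFn_toLp 2 volume] with v h1 h2
  rw [h1, Pi.sub_apply, h2]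

theorem enorm_fourier_sub_schwartz (g : Lp (α := E3) ℂ 2 volume) (f : SchwartzMap E3 ℂ) :
    ‖𝓕 g - (𝓕 f).toLp 2 volume‖ₑ = ‖g - f.toLp 2 volume‖ₑ := by
  have e1 : 𝓕 g - (𝓕 f).toLp 2 volume =
      Lp.fourierTransformₗᵢ E3 ℂ (g - f.toLp 2 volume) := by
    rw [map_sub, ← SchwartzMap.toLp_fourier_eq]
    rfl
  rw [e1, ← ofReal_norm, ← ofReal_norm, LinearIsometryEquiv.norm_map]

/-- The inequality `‖g(· + h) - g‖ ≤ ‖(e^{2πi⟨h,·⟩} - 1) A‖` passes from a pair `(f, F)` to a nearby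
pair `(g, A)`. The functions are arbitrary here; in the application `F = 𝓕 f` and `A = 𝓕 g`. -/
theorem eLpNorm_translate_sub_le_of_approx {g f A F : E3 → ℂ} (h : E3)
    (hg : AEStronglyMeasurable g volume) (hf : AEStronglyMeasurable f volume)
    (hA : AEStronglyMeasurable A volume) (hF : AEStronglyMeasurable F volume)
    (hfF : eLpNorm (fun v => f (v + h) - f v) 2 volume =
      eLpNorm (fun ξ => diffSymbol h ξ * F ξ) 2 volume)
    {δ : ℝ≥0∞} (hgf : eLpNorm (fun v => g v - f v) 2 volume = δ)
    (hAF : eLpNorm (fun v => A v - F v) 2 volume = δ) :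
    eLpNorm (fun v => g (v + h) - g v) 2 volume ≤
      eLpNorm (fun ξ => diffSymbol h ξ * A ξ) 2 volume + 4 * δ := by
  have hmp : MeasurePreserving (fun v : E3 => v + h) volume volume :=
    measurePreserving_add_right volume h
  have hm : AEStronglyMeasurable (diffSymbol h) volume :=
    (continuous_diffSymbol h).aestronglyMeasurable
  have hgh : AEStronglyMeasurable (fun v => g (v + h) - f (v + h)) volume :=
    (hg.sub hf).comp_measurePreserving hmp
  have hfh : AEStronglyMeasurable (fun v => f (v + h) - f v) volume :=
    (hf.comp_measurePreserving hmp).sub hf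
  have hgf' : AEStronglyMeasurable (fun v => g v - f v) volume := hg.sub hf
  have hmA : AEStronglyMeasurable (fun ξ => diffSymbol h ξ * A ξ) volume := hm.mul hA
  have hmAF : AEStronglyMeasurable (fun ξ => diffSymbol h ξ * (A ξ - F ξ)) volume :=
    hm.mul (hA.sub hF)
  have d1 : eLpNorm (fun v => g (v + h) - f (v + h)) 2 volume = δ := by
    rw [← hgf]
    exact eLpNorm_comp_measurePreserving (g := fun v => g v - f v)
      (f := fun v => v + h) hgf' hmp
  have d3 : eLpNorm (fun ξ => diffSymbol h ξ * (A ξ - F ξ)) 2 volume ≤ 2 * δ := by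
    rw [← hAF]
    have hle : ∀ ξ, ‖diffSymbol h ξ * (A ξ - F ξ)‖ ≤ 2 * ‖A ξ - F ξ‖ := fun ξ =>
      (norm_mul_le _ _).trans
        (mul_le_mul_of_nonneg_right (norm_diffSymbol_le_two h ξ) (norm_nonneg _))
    have := eLpNorm_le_mul_eLpNorm_of_ae_le_mul (μ := volume)
      (Filter.Eventually.of_forall hle) 2
    simpa using this
  calc eLpNorm (fun v => g (v + h) - g v) 2 volume
      = eLpNorm ((fun v => f (v + h) - f v) +
          ((fun v => g (v + h) - f (v + h)) - fun v => g v - f v)) 2 volume := by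
        congr 1; ext v; simp only [Pi.add_apply, Pi.sub_apply]; ring
    _ ≤ eLpNorm (fun v => f (v + h) - f v) 2 volume +
          (eLpNorm (fun v => g (v + h) - f (v + h)) 2 volume +
            eLpNorm (fun v => g v - f v) 2 volume) := by
        refine (eLpNorm_add_le hfh (hgh.sub hgf') (by norm_num)).trans ?_
        gcongr
        exact eLpNorm_sub_le hgh hgf' (by norm_num)
    _ = eLpNorm ((fun ξ => diffSymbol h ξ * A ξ) -
          fun ξ => diffSymbol h ξ * (A ξ - F ξ)) 2 volume + 2 * δ := by
        rw [hgf, d1, hfF, ← two_mul]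
        congr 2
        ext ξ; simp only [Pi.sub_apply]; ring
    _ ≤ _ := by
        have e4 : (4 : ℝ≥0∞) = 2 + 2 := by norm_num
        rw [e4, add_mul, ← add_assoc]
        gcongr
        refine (eLpNorm_sub_le hmA hmAF (by norm_num)).trans ?_
        gcongr

/-- One half of Plancherel's identity for the difference operator on `L²`, by density of the
Schwartz functions. -/
theorem eLpNorm_translate_sub_le (g : Lp (α := E3) ℂ 2 volume) (h : E3) :
    eLpNorm (fun v => g (v + h) - g v) 2 volume ≤
      eLpNorm (fun ξ => diffSymbol h ξ * (𝓕 g : Lp (α := E3) ℂ 2 volume) ξ) 2 volume := by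
  have key : ∀ f : SchwartzMap E3 ℂ, eLpNorm (fun v => g (v + h) - g v) 2 volume ≤
      eLpNorm (fun ξ => diffSymbol h ξ * (𝓕 g : Lp (α := E3) ℂ 2 volume) ξ) 2 volume +
        4 * ‖g - f.toLp 2 volume‖ₑ := fun f =>
    eLpNorm_translate_sub_le_of_approx h (Lp.aestronglyMeasurable g)
      f.continuous.aestronglyMeasurable (Lp.aestronglyMeasurable _)
      (𝓕 f).continuous.aestronglyMeasurable (eLpNorm_translate_sub_schwartz f h)
      (eLpNorm_coe_sub_schwartz g f)
      ((eLpNorm_coe_sub_schwartz _ _).trans (enorm_fourier_sub_schwartz g f))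
  refine ENNReal.le_of_forall_pos_le_add fun ε hε _ => ?_
  obtain ⟨f, hf⟩ := (SchwartzMap.denseRange_toLpCLM (E := E3) (F := ℂ) (p := 2)
    ENNReal.ofNat_ne_top (μ := volume)).exists_dist_lt g
      (show (0 : ℝ) < ε / 4 by positivity)
  refine (key f).trans ?_
  gcongr
  rw [dist_eq_norm, SchwartzMap.toLpCLM_apply] at hf
  rw [← ofReal_norm]
  calc 4 * ENNReal.ofReal ‖g - f.toLp 2 volume‖ ≤ 4 * ENNReal.ofReal (ε / 4) := by gcongr
    _ = ε := by
      rw [show (4 : ℝ≥0∞) = ENNReal.ofReal 4 by norm_num, ← ENNReal.ofReal_mul (by norm_num),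
        mul_div_cancel₀ _ (by norm_num), ENNReal.ofReal_coe_nnreal]

theorem lintegral_comp_smul_E3 {c : ℝ} (hc : c ≠ 0) (f : E3 → ℝ≥0∞) :
    ∫⁻ v, f v = ENNReal.ofReal (|c| ^ 3) * ∫⁻ v, f (c • v) := by
  have h1 := (Homeomorph.smulOfNeZero c hc).measurableEmbedding.lintegral_map (μ := volume) f
  have h2 := Measure.map_addHaar_smul (volume : Measure E3) hc
  simp only [Homeomorph.smulOfNeZero_apply] at h1
  change ∫⁻ a, f a ∂(Measure.map (fun x => c • x) volume) = _ at h1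
  rw [← h1, h2, lintegral_smul_measure, smul_eq_mul, ← mul_assoc,
    ← ENNReal.ofReal_mul (by positivity)]
  have : |c| ^ 3 * |(c ^ Module.finrank ℝ E3)⁻¹| = 1 := by
    have : |c| ≠ 0 := by simpa using hc
    simp only [finrank_euclideanSpace, Fintype.card_fin, abs_inv, abs_pow]
    field_simp
  rw [this, ENNReal.ofReal_one, one_mul]

/-- Finite Sobolev norm bounds the `L²` modulus of continuity: `‖g(· + h) - g‖² ≲ |h|^{2s}`. -/
theorem lintegral_translate_sub_sq_le {s : ℝ} (hs0 : 0 < s) (hs1 : s < 1) {g : E3 → ℝ}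
    (hg : MemLp (fun v => (g v : ℂ)) 2 volume) (h : E3) :
    ∫⁻ v, ‖g (v + h) - g v‖ₑ ^ 2 ≤
      4 * sobolevNormSq s g * ENNReal.ofReal (‖h‖ ^ (2 * s)) := by
  set G : Lp (α := E3) ℂ 2 volume := hg.toLp (fun v => (g v : ℂ)) with hG
  have hmp : MeasurePreserving (fun v : E3 => v + h) volume volume :=
    measurePreserving_add_right volume h
  have e1 : ∫⁻ v, ‖g (v + h) - g v‖ₑ ^ 2 = ∫⁻ v, ‖G (v + h) - G v‖ₑ ^ 2 := by
    refine lintegral_congr_ae ?_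
    have := hg.coeFn_toLp
    filter_upwards [this, hmp.quasiMeasurePreserving.ae this] with v h1 h2
    rw [← hG] at h1 h2
    rw [h1, h2, ← Complex.ofReal_sub, ← ofReal_norm, ← ofReal_norm, Complex.norm_real]
  rw [e1, ← eLpNorm_two_sq]
  calc eLpNorm (fun v => G (v + h) - G v) 2 volume ^ 2
      ≤ eLpNorm (fun ξ => diffSymbol h ξ * (𝓕 G : Lp (α := E3) ℂ 2 volume) ξ) 2 volume ^ 2 := by
        gcongr
        exact eLpNorm_translate_sub_le G h
    _ = ∫⁻ ξ, ‖diffSymbol h ξ * (𝓕 G : Lp (α := E3) ℂ 2 volume) ξ‖ₑ ^ 2 :=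
        eLpNorm_two_sq _
    -- The substitution `ξ ↦ ξ / 2π` has Jacobian `(2π)⁻³ ≤ 1`.
    _ ≤ ∫⁻ ξ, ‖diffSymbol h ((2 * Real.pi)⁻¹ • ξ) * fourierL2 G ξ‖ₑ ^ 2 := by
        rw [lintegral_comp_smul_E3 (c := (2 * Real.pi)⁻¹) (by positivity)]
        refine mul_le_of_le_one_left (by positivity) ?_
        rw [ENNReal.ofReal_le_one]
        refine pow_le_one₀ (abs_nonneg _) ?_
        rw [abs_of_pos (by positivity)]
        exact inv_le_one_of_one_le₀ (by nlinarith [Real.pi_gt_three])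
    _ ≤ ∫⁻ ξ, (4 * ENNReal.ofReal (‖h‖ ^ (2 * s))) *
          ENNReal.ofReal (‖fourierL2 G ξ‖ ^ 2 * ‖ξ‖ ^ (2 * s)) := by
        refine lintegral_mono fun ξ => ?_
        rw [← ofReal_norm, ← ENNReal.ofReal_pow (norm_nonneg _),
          show (4 : ℝ≥0∞) = ENNReal.ofReal 4 by norm_num, ← ENNReal.ofReal_mul (by norm_num),
          ← ENNReal.ofReal_mul (by positivity)]
        refine ENNReal.ofReal_le_ofReal ?_
        have h1 := norm_diffSymbol_le hs0 hs1 h ((2 * Real.pi)⁻¹ • ξ)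
        rw [smul_inv_smul₀ (by positivity)] at h1
        have h2 : ((‖h‖ * ‖ξ‖) ^ s) ^ 2 = ‖h‖ ^ (2 * s) * ‖ξ‖ ^ (2 * s) := by
          rw [← Real.mul_rpow (norm_nonneg _) (norm_nonneg _), ← Real.rpow_natCast,
            ← Real.rpow_mul (by positivity)]
          congr 1; push_cast; ring
        rw [norm_mul, mul_pow]
        calc _ ≤ (2 * (‖h‖ * ‖ξ‖) ^ s) ^ 2 * ‖fourierL2 G ξ‖ ^ 2 := by gcongr
          _ = _ := by rw [mul_pow, h2]; ring
    _ = 4 * ENNReal.ofReal (‖h‖ ^ (2 * s)) *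
          ∫⁻ ξ, ENNReal.ofReal (‖fourierL2 G ξ‖ ^ 2 * ‖ξ‖ ^ (2 * s)) :=
        lintegral_const_mul' _ _ (ENNReal.mul_ne_top (by norm_num) ENNReal.ofReal_ne_top)
    _ ≤ _ := by
        rw [sobolevNormSq, dif_pos hg, mul_right_comm]
        gcongr
        exact le_self_add

theorem lintegral_sq_le_sobolevNormSq {s : ℝ} {g : E3 → ℝ}
    (hg : MemLp (fun v => (g v : ℂ)) 2 volume) : ∫⁻ v, ‖g v‖ₑ ^ 2 ≤ sobolevNormSq s g := by
  rw [sobolevNormSq, dif_pos hg, ← eLpNorm_two_sq]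
  exact le_add_self

theorem memLp_of_sobolevNormSq_lt_top {s : ℝ} {g : E3 → ℝ} (h : sobolevNormSq s g < ⊤) :
    MemLp (fun v => (g v : ℂ)) 2 volume := by
  by_contra hg
  simp [sobolevNormSq, hg] at h

theorem sobolevNormSq_congr {s : ℝ} {g g' : E3 → ℝ} (h : g =ᵐ[volume] g') :
    sobolevNormSq s g = sobolevNormSq s g' := by
  have hc : (fun v => (g v : ℂ)) =ᵐ[volume] fun v => (g' v : ℂ) := by
    filter_upwards [h] with v hv
    rw [hv]
  by_cases hg : MemLp (fun v => (g v : ℂ)) 2 volume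
  · have hg' := (memLp_congr_ae hc).1 hg
    rw [sobolevNormSq, sobolevNormSq, dif_pos hg, dif_pos hg', eLpNorm_congr_ae h,
      (MemLp.toLp_eq_toLp_iff hg hg').2 hc]
  · have hg' := fun H => hg ((memLp_congr_ae hc).2 H)
    rw [sobolevNormSq, sobolevNormSq, dif_neg hg, dif_neg hg']

/-! ### The trace inequality for singular kernels -/

/-- The bilinear form `∬ F(w) k(v - w) g(v) dv dw` of a nonnegative convolution kernel `k`. -/
noncomputable def kernelForm (k F g : E3 → ℝ≥0∞) : ℝ≥0∞ := ∫⁻ w, ∫⁻ v, F w * k (v - w) * g v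

/-- The kernel `𝟙_{|x| ≤ r}`. -/
noncomputable def ballKernel (r : ℝ) : E3 → ℝ≥0∞ := (Metric.closedBall 0 r).indicator 1

theorem measurable_ballKernel (r : ℝ) : Measurable (ballKernel r) :=
  measurable_one.indicator Metric.isClosed_closedBall.measurableSet

theorem ballKernel_of_le {r : ℝ} {x : E3} (h : ‖x‖ ≤ r) : ballKernel r x = 1 := by
  simp [ballKernel, h]

theorem ballKernel_of_lt {r : ℝ} {x : E3} (h : r < ‖x‖) : ballKernel r x = 0 := by
  simp [ballKernel, h]

theorem lintegral_ballKernel_sub (r : ℝ) (w : E3) :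
    ∫⁻ v, ballKernel r (v - w) = volume (Metric.closedBall (0 : E3) r) := by
  rw [lintegral_sub_right_eq_self (ballKernel r) w, ballKernel,
    lintegral_indicator_one Metric.isClosed_closedBall.measurableSet]

theorem volume_closedBall_E3 {r : ℝ} (hr : 0 ≤ r) :
    volume (Metric.closedBall (0 : E3) r) =
      ENNReal.ofReal (r ^ 3) * volume (Metric.ball (0 : E3) 1) := by
  rw [Measure.addHaar_closedBall _ _ hr, finrank_euclideanSpace, Fintype.card_fin]

section
variable {k F g : E3 → ℝ≥0∞}

theorem kernelForm_eq_swap (hk : Measurable k) (hF : Measurable F) (hg : Measurable g) :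
    kernelForm k F g = ∫⁻ v, (∫⁻ w, F w * k (v - w)) * g v := by
  unfold kernelForm
  rw [lintegral_lintegral_swap]
  · refine lintegral_congr fun v => ?_
    rw [lintegral_mul_const _ (by fun_prop)]
  · exact Measurable.aemeasurable (by unfold Function.uncurry; fun_prop)

theorem kernelForm_le_of_forall_le (hk : Measurable k) (hF : Measurable F) (hg : Measurable g)
    {M : ℝ≥0∞} (hM : ∀ v, ∫⁻ w, F w * k (v - w) ≤ M) :
    kernelForm k F g ≤ M * ∫⁻ v, g v := by
  rw [kernelForm_eq_swap hk hF hg, ← lintegral_const_mul _ hg]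
  gcongr with v
  exact hM v

theorem kernelForm_mono {k' : E3 → ℝ≥0∞} (h : ∀ x, k x ≤ k' x) :
    kernelForm k F g ≤ kernelForm k' F g := by
  unfold kernelForm
  gcongr with w v
  exact h _

end

/-- Average over the translations `|h| ≤ R` of the mass of `g(· + h)` seen by `𝟙_{|x| ≤ r}`. -/
theorem lintegral_kernelForm_translate_le {F g : E3 → ℝ≥0∞} (hF : Measurable F)
    (hg : Measurable g) (r R : ℝ) :
    ∫⁻ h in Metric.closedBall (0 : E3) R, kernelForm (ballKernel r) F (fun v => g (v + h)) ≤
      volume (Metric.closedBall (0 : E3) r) * kernelForm (ballKernel (R + r)) F g := by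
  have hk := measurable_ballKernel r
  have hk' := measurable_ballKernel (R + r)
  have inner : ∀ w v : E3, ∫⁻ h in Metric.closedBall (0 : E3) R,
      F w * ballKernel r (v - w) * g (v + h) ≤
        ballKernel r (v - w) * ∫⁻ u, F w * ballKernel (R + r) (u - w) * g u := by
    intro w v
    -- If `|v - w| ≤ r`, the ball of radius `R` about `v` lies in the ball of radius `R + r`
    -- about `w`.
    rcases le_or_gt ‖v - w‖ r with h | h
    · rw [ballKernel_of_le h, one_mul, mul_one,
        ← lintegral_add_left_eq_self (fun u => F w * ballKernel (R + r) (u - w) * g u) v]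
      refine le_trans ?_ (setLIntegral_le_lintegral (Metric.closedBall 0 R) _)
      refine setLIntegral_mono' Metric.isClosed_closedBall.measurableSet fun x hx => ?_
      rw [ballKernel_of_le, mul_one]
      rw [mem_closedBall_zero_iff] at hx
      calc ‖v + x - w‖ = ‖x + (v - w)‖ := by congr 1; abel
        _ ≤ R + r := (norm_add_le _ _).trans (add_le_add hx h)
    · simp [ballKernel_of_lt h]
  calc ∫⁻ h in Metric.closedBall (0 : E3) R, kernelForm (ballKernel r) F (fun v => g (v + h))
      = ∫⁻ w, ∫⁻ h in Metric.closedBall (0 : E3) R, ∫⁻ v,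
          F w * ballKernel r (v - w) * g (v + h) := by
        unfold kernelForm
        rw [lintegral_lintegral_swap]
        refine Measurable.aemeasurable ?_
        exact Measurable.lintegral_prod_right'
          (f := fun p : (E3 × E3) × E3 => F p.1.2 * ballKernel r (p.2 - p.1.2) * g (p.2 + p.1.1))
          (by fun_prop)
    _ = ∫⁻ w, ∫⁻ v, ∫⁻ h in Metric.closedBall (0 : E3) R,
          F w * ballKernel r (v - w) * g (v + h) := by
        refine lintegral_congr fun w => lintegral_lintegral_swap ?_
        exact Measurable.aemeasurable (by unfold Function.uncurry; fun_prop)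
    _ ≤ ∫⁻ w, ∫⁻ v, ballKernel r (v - w) *
          ∫⁻ u, F w * ballKernel (R + r) (u - w) * g u := by
        gcongr with w v
        exact inner w v
    _ = ∫⁻ w, volume (Metric.closedBall (0 : E3) r) *
          ∫⁻ u, F w * ballKernel (R + r) (u - w) * g u := by
        refine lintegral_congr fun w => ?_
        rw [lintegral_mul_const _ (by fun_prop), lintegral_ballKernel_sub]
    _ = _ := by
        rw [lintegral_const_mul]
        · rfl
        · exact Measurable.lintegral_prod_right'
            (f := fun p : E3 × E3 => F p.1 * ballKernel (R + r) (p.2 - p.1) * g p.2)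
            (by fun_prop)

theorem enorm_sq_le_two_mul (a b : ℝ) : ‖a‖ₑ ^ 2 ≤ 2 * ‖b - a‖ₑ ^ 2 + 2 * ‖b‖ₑ ^ 2 := by
  simp only [← ofReal_norm, Real.norm_eq_abs]
  rw [← ENNReal.ofReal_pow (abs_nonneg _), ← ENNReal.ofReal_pow (abs_nonneg _),
    ← ENNReal.ofReal_pow (abs_nonneg _), show (2 : ℝ≥0∞) = ENNReal.ofReal 2 by norm_num,
    ← ENNReal.ofReal_mul (by norm_num), ← ENNReal.ofReal_mul (by norm_num),
    ← ENNReal.ofReal_add (by positivity) (by positivity)]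
  refine ENNReal.ofReal_le_ofReal ?_
  simp only [sq_abs]
  nlinarith [sq_nonneg (2 * b - a)]

/-- Comparing `G` with its translates `G(· + h)`, `|h| ≤ R`, controls the form at the scale `r` by
the modulus of continuity of `G` and by a fraction `2(r/R)³` of the form at the scale `R + r`. -/
theorem kernelForm_ball_le {F : E3 → ℝ≥0∞} {G : E3 → ℝ} (hF : Measurable F) (hG : Measurable G)
    {r R : ℝ} (hr : 0 ≤ r) (hR : 0 < R) {M D : ℝ≥0∞}
    (hM : ∀ v, ∫⁻ w, F w * ballKernel r (v - w) ≤ M)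
    (hD : ∀ h : E3, ‖h‖ ≤ R → ∫⁻ v, ‖G (v + h) - G v‖ₑ ^ 2 ≤ D) :
    kernelForm (ballKernel r) F (fun v => ‖G v‖ₑ ^ 2) ≤
      2 * (M * D) + ENNReal.ofReal (2 * (r / R) ^ 3) *
        kernelForm (ballKernel (R + r)) F (fun v => ‖G v‖ₑ ^ 2) := by
  have hk := measurable_ballKernel r
  set V := volume (Metric.closedBall (0 : E3) R) with hV
  have hV0 : V ≠ 0 := (Metric.measure_closedBall_pos volume _ hR).ne'
  have hVt : V ≠ ⊤ := measure_closedBall_lt_top.ne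
  have step : ∀ h : E3, ‖h‖ ≤ R → kernelForm (ballKernel r) F (fun v => ‖G v‖ₑ ^ 2) ≤
      2 * (M * D) + 2 * kernelForm (ballKernel r) F (fun v => ‖G (v + h)‖ₑ ^ 2) := by
    intro h hh
    have h1 : kernelForm (ballKernel r) F (fun v => ‖G (v + h) - G v‖ₑ ^ 2) ≤ M * D :=
      (kernelForm_le_of_forall_le hk hF (by fun_prop) hM).trans (by gcongr; exact hD h hh)
    refine le_trans ?_ (add_le_add_left (mul_le_mul_right h1 2) _)
    rw [kernelForm_eq_swap hk hF (by fun_prop), kernelForm_eq_swap hk hF (by fun_prop),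
      kernelForm_eq_swap hk hF (by fun_prop)]
    have hm : Measurable fun v => ∫⁻ w, F w * ballKernel r (v - w) :=
      Measurable.lintegral_prod_right'
        (f := fun p : E3 × E3 => F p.2 * ballKernel r (p.1 - p.2)) (by fun_prop)
    rw [← lintegral_const_mul _ (by fun_prop), ← lintegral_const_mul _ (by fun_prop),
      ← lintegral_add_left (by fun_prop)]
    gcongr with v
    calc _ ≤ (∫⁻ w, F w * ballKernel r (v - w)) *
          (2 * ‖G (v + h) - G v‖ₑ ^ 2 + 2 * ‖G (v + h)‖ₑ ^ 2) := by
          gcongr; exact enorm_sq_le_two_mul _ _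
      _ = _ := by ring
  have avg : V * kernelForm (ballKernel r) F (fun v => ‖G v‖ₑ ^ 2) ≤
      V * (2 * (M * D) + ENNReal.ofReal (2 * (r / R) ^ 3) *
        kernelForm (ballKernel (R + r)) F (fun v => ‖G v‖ₑ ^ 2)) := by
    calc V * kernelForm (ballKernel r) F (fun v => ‖G v‖ₑ ^ 2)
        = ∫⁻ h in Metric.closedBall (0 : E3) R,
            kernelForm (ballKernel r) F (fun v => ‖G v‖ₑ ^ 2) := by
          rw [setLIntegral_const, mul_comm]
      _ ≤ ∫⁻ h in Metric.closedBall (0 : E3) R, (2 * (M * D) +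
            2 * kernelForm (ballKernel r) F (fun v => ‖G (v + h)‖ₑ ^ 2)) := by
          refine setLIntegral_mono' Metric.isClosed_closedBall.measurableSet fun h hh => ?_
          exact step h (mem_closedBall_zero_iff.1 hh)
      _ = V * (2 * (M * D)) + 2 * ∫⁻ h in Metric.closedBall (0 : E3) R,
            kernelForm (ballKernel r) F (fun v => ‖G (v + h)‖ₑ ^ 2) := by
          rw [lintegral_add_left measurable_const, setLIntegral_const, mul_comm,
            lintegral_const_mul' _ _ (by norm_num)]
      _ ≤ V * (2 * (M * D)) + 2 * (volume (Metric.closedBall (0 : E3) r) *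
            kernelForm (ballKernel (R + r)) F (fun v => ‖G v‖ₑ ^ 2)) := by
          gcongr
          exact lintegral_kernelForm_translate_le (g := fun v => ‖G v‖ₑ ^ 2) hF (by fun_prop) r R
      _ = _ := by
          have e : 2 * volume (Metric.closedBall (0 : E3) r) =
              V * ENNReal.ofReal (2 * (r / R) ^ 3) := by
            have e0 : ENNReal.ofReal (r ^ 3) =
                ENNReal.ofReal (R ^ 3) * ENNReal.ofReal ((r / R) ^ 3) := by
              rw [← ENNReal.ofReal_mul (by positivity)]
              congr 1
              field_simp
            rw [hV, volume_closedBall_E3 hr, volume_closedBall_E3 hR.le, e0,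
              ENNReal.ofReal_mul zero_le_two, ENNReal.ofReal_ofNat]
            ring
          rw [← mul_assoc 2 (volume _), e, mul_assoc, ← mul_add]
  exact (ENNReal.mul_le_mul_iff_right hV0 hVt).1 avg

/-- A sequence with `b (n + 1) ≤ c n + b n / 2` has `∑ b ≤ 2 (b 0 + ∑ c)`, even if the sum on the
left is not known to be finite beforehand. -/
theorem ENNReal.tsum_le_of_contraction {b c : ℕ → ℝ≥0∞}
    (h : ∀ n, b (n + 1) ≤ c n + 2⁻¹ * b n) : ∑' n, b n ≤ 2 * (b 0 + ∑' n, c n) := by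
  have hfin : ∀ N, ∑ n ∈ Finset.range N, b n + 2 * b N ≤
      2 * (b 0 + ∑ n ∈ Finset.range N, c n) := by
    intro N
    induction N with
    | zero => simp
    | succ N ih =>
      rw [Finset.sum_range_succ, Finset.sum_range_succ]
      calc ∑ n ∈ Finset.range N, b n + b N + 2 * b (N + 1)
          ≤ ∑ n ∈ Finset.range N, b n + b N + 2 * (c N + 2⁻¹ * b N) := by gcongr; exact h N
        _ = (∑ n ∈ Finset.range N, b n + 2 * b N) + 2 * c N := by
          rw [mul_add, ← mul_assoc, ENNReal.mul_inv_cancel (by norm_num) (by norm_num)]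
          ring
        _ ≤ 2 * (b 0 + ∑ n ∈ Finset.range N, c n) + 2 * c N := by gcongr
        _ = _ := by ring
  refine ENNReal.tsum_le_of_sum_range_le fun N => ?_
  refine le_self_add.trans ((hfin N).trans ?_)
  gcongr
  exact ENNReal.sum_le_tsum _

/-- A ratio of scales for which the averaged comparison contracts the weighted form by `1/2`. -/
theorem exists_contracting_ratio {a : ℝ} (ha : a < 3) :
    ∃ c : ℝ, 0 < c ∧ c ≤ 1 / 2 ∧ c ^ (-a) * (2 * (c / (1 - c)) ^ 3) ≤ 1 / 2 := by
  refine ⟨min (1 / 2) ((1 / 32) ^ (1 / (3 - a))), by positivity, min_le_left _ _, ?_⟩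
  set c : ℝ := min (1 / 2) ((1 / 32) ^ (1 / (3 - a))) with hc
  have hc0 : 0 < c := by positivity
  have hc1 : c ≤ 1 / 2 := min_le_left _ _
  have h1 : c ^ (3 - a) ≤ 1 / 32 := by
    calc c ^ (3 - a) ≤ ((1 / 32 : ℝ) ^ (1 / (3 - a))) ^ (3 - a) :=
          Real.rpow_le_rpow hc0.le (min_le_right _ _) (by linarith)
      _ = 1 / 32 := by
          rw [← Real.rpow_mul (by norm_num), one_div_mul_cancel (by linarith), Real.rpow_one]
  have h2 : c / (1 - c) ≤ 2 * c := by
    rw [div_le_iff₀ (by linarith)]; nlinarith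
  have h3 : c ^ (3 - a) = c ^ (-a) * c ^ 3 := by
    rw [← Real.rpow_natCast c 3, ← Real.rpow_add hc0]; congr 1; push_cast; ring
  have h4 : 0 ≤ c / (1 - c) := div_nonneg hc0.le (by linarith)
  calc c ^ (-a) * (2 * (c / (1 - c)) ^ 3) ≤ c ^ (-a) * (2 * (2 * c) ^ 3) := by gcongr
    _ = 16 * c ^ (3 - a) := by rw [h3]; ring
    _ ≤ _ := by linarith

/-- The kernel `|x|^{-a}` restricted to `|x| ≤ 1`. -/
noncomputable def nearKernel (a : ℝ) (x : E3) : ℝ≥0∞ := ENNReal.ofReal (‖x‖ ^ (-a)) * ballKernel 1 x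

theorem measurable_nearKernel (a : ℝ) : Measurable (nearKernel a) := by
  have := measurable_ballKernel 1
  unfold nearKernel
  fun_prop

/-- The singular kernel is dominated by ball kernels at the geometric scales `c ^ n`. -/
theorem nearKernel_le_tsum {a c : ℝ} (ha : 0 < a) (hc0 : 0 < c) (hc1 : c < 1) (x : E3) :
    nearKernel a x ≤ ∑' n : ℕ, ENNReal.ofReal ((c ^ (n + 1)) ^ (-a)) * ballKernel (c ^ n) x := by
  unfold nearKernel
  rcases eq_or_ne x 0 with rfl | hx
  -- In Lean `0 ^ (-a) = 0`, so that the inequality also holds at the singularity.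
  · rw [norm_zero, Real.zero_rpow (by linarith)]; simp
  rcases lt_or_ge 1 ‖x‖ with h | h
  · rw [ballKernel_of_lt h, mul_zero]; exact zero_le
  obtain ⟨n, hn1, hn2⟩ := exists_nat_pow_near_of_lt_one (norm_pos_iff.2 hx) h hc0 hc1
  refine le_trans ?_ (ENNReal.le_tsum n)
  rw [ballKernel_of_le h, ballKernel_of_le hn2]
  gcongr ENNReal.ofReal ?_ * 1
  exact Real.rpow_le_rpow_of_nonpos (by positivity) hn1.le (by linarith)

theorem kernelForm_tsum {k : ℕ → E3 → ℝ≥0∞} {F g : E3 → ℝ≥0∞} (hk : ∀ n, Measurable (k n))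
    (hF : Measurable F) (hg : Measurable g) (t : ℕ → ℝ≥0∞) :
    kernelForm (fun x => ∑' n, t n * k n x) F g = ∑' n, t n * kernelForm (k n) F g := by
  unfold kernelForm
  have hm : ∀ n, Measurable fun w => ∫⁻ v, F w * k n (v - w) * g v := fun n =>
    Measurable.lintegral_prod_right'
      (f := fun p : E3 × E3 => F p.1 * k n (p.2 - p.1) * g p.2) (by have := hk n; fun_prop)
  have hm' : ∀ n w, Measurable fun v => F w * k n (v - w) * g v := fun n w => by
    have := hk n; fun_prop
  simp_rw [← lintegral_const_mul _ (hm _)]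
  rw [← lintegral_tsum fun n => ((hm n).const_mul _).aemeasurable]
  refine lintegral_congr fun w => ?_
  simp_rw [← lintegral_const_mul _ (hm' _ w)]
  rw [← lintegral_tsum fun n => ((hm' n w).const_mul _).aemeasurable]
  refine lintegral_congr fun v => ?_
  rw [← ENNReal.tsum_mul_left, ← ENNReal.tsum_mul_right]
  congr 1; ext n; ring

/-- A trace inequality: if `F` has mass `≲ r^κ` in balls of radius `r ≤ 1` and `G` has the
`L²` modulus of continuity `|h|^s`, then `F` can be integrated against `|x|^{-a} 𝟙_{|x| ≤ 1} * G²`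
for every `a < κ + 2s`. -/
theorem exists_kernelForm_nearKernel_le {a κ s : ℝ} (ha0 : 0 < a) (ha3 : a < 3) (hs : 0 < s)
    (h : a < κ + 2 * s) :
    ∃ C : ℝ≥0∞, C ≠ ⊤ ∧ ∀ (F : E3 → ℝ≥0∞) (G : E3 → ℝ) (Φ A : ℝ≥0∞), Measurable F →
      Measurable G →
      (∀ r : ℝ, 0 < r → r ≤ 1 → ∀ v, ∫⁻ w, F w * ballKernel r (v - w) ≤
        Φ * ENNReal.ofReal (r ^ κ)) →
      (∀ h : E3, ∫⁻ v, ‖G (v + h) - G v‖ₑ ^ 2 ≤ A * ENNReal.ofReal (‖h‖ ^ (2 * s))) →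
      ∫⁻ v, ‖G v‖ₑ ^ 2 ≤ A →
      kernelForm (nearKernel a) F (fun v => ‖G v‖ₑ ^ 2) ≤ C * (Φ * A) := by
  obtain ⟨c, hc0, hc2, hc⟩ := exists_contracting_ratio ha3
  have hc1 : c < 1 := by linarith
  set θ : ℝ := c ^ (κ + 2 * s - a) with hθ
  have hθ0 : 0 ≤ θ := by positivity
  have hθ1 : θ < 1 := Real.rpow_lt_one hc0.le hc1 (by linarith)
  set S : ℝ≥0∞ := (1 - ENNReal.ofReal θ)⁻¹ with hS
  have hSt : S ≠ ⊤ := by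
    rw [hS, ENNReal.inv_ne_top, ← pos_iff_ne_zero, tsub_pos_iff_lt, ENNReal.ofReal_lt_one]
    exact hθ1
  refine ⟨ENNReal.ofReal (c ^ (-a)) * (2 * (1 + 2 * ENNReal.ofReal (c ^ (κ - a)) * S)), ?_, ?_⟩
  · finiteness
  intro F G Φ A hF hG hΦ hA hA0
  have hg : Measurable fun v => ‖G v‖ₑ ^ 2 := by fun_prop
  -- `b n` is the form at the scale `c ^ n`, with the size of the kernel `|x|^{-a}` there.
  set T : ℝ → ℝ≥0∞ := fun r => kernelForm (ballKernel r) F (fun v => ‖G v‖ₑ ^ 2) with hT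
  set b : ℕ → ℝ≥0∞ := fun n => ENNReal.ofReal ((c ^ n) ^ (-a)) * T (c ^ n) with hb
  have hb0 : b 0 ≤ Φ * A := by
    have h1 : T 1 ≤ Φ * A := by
      refine (kernelForm_le_of_forall_le (measurable_ballKernel 1) hF hg (M := Φ) ?_).trans ?_
      · intro v
        simpa using hΦ 1 one_pos le_rfl v
      · gcongr
    simpa [hb] using h1
  have hstep : ∀ n, b (n + 1) ≤
      2 * (Φ * A) * ENNReal.ofReal (c ^ (κ - a)) * ENNReal.ofReal θ ^ n + 2⁻¹ * b n := by
    intro n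
    have hr : 0 < c ^ n := by positivity
    set r := c ^ n with hrdef
    have hr1 : r ≤ 1 := pow_le_one₀ hc0.le hc1.le
    have hcr : c ^ (n + 1) = c * r := by rw [hrdef]; ring
    have hR : 0 < (1 - c) * r := mul_pos (by linarith) hr
    -- The radius of averaging is chosen so that the coarse scale `R + c r` is `r` itself.
    have key := kernelForm_ball_le (r := c * r) (R := (1 - c) * r) hF hG (by positivity) hR
      (hΦ (c * r) (by positivity) (by nlinarith))
      (D := A * ENNReal.ofReal (r ^ (2 * s))) (fun h hh => (hA h).trans (by
        gcongr
        nlinarith))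
    have e1 : (1 - c) * r + c * r = r := by ring
    have e2 : c * r / ((1 - c) * r) = c / (1 - c) := by
      rw [mul_div_mul_right _ _ hr.ne']
    rw [e1, e2] at key
    have e3 : (c * r) ^ (-a) = c ^ (-a) * r ^ (-a) := Real.mul_rpow hc0.le hr.le
    have e4 : ENNReal.ofReal ((c * r) ^ (-a)) * (2 * (Φ * ENNReal.ofReal ((c * r) ^ κ) *
        (A * ENNReal.ofReal (r ^ (2 * s))))) =
        2 * (Φ * A) * ENNReal.ofReal (c ^ (κ - a)) * ENNReal.ofReal θ ^ n := by
      have e5 : (c * r) ^ (-a) * (c * r) ^ κ * r ^ (2 * s) = c ^ (κ - a) * θ ^ n := by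
        have : θ ^ n = r ^ (κ + 2 * s - a) := by
          rw [hθ, hrdef, ← Real.rpow_natCast, ← Real.rpow_natCast, ← Real.rpow_mul hc0.le,
            ← Real.rpow_mul hc0.le, mul_comm]
        rw [this, ← Real.rpow_add (by positivity), Real.mul_rpow hc0.le hr.le, mul_assoc,
          ← Real.rpow_add hr]
        congr 2 <;> ring
      rw [← ENNReal.ofReal_pow hθ0]
      calc _ = 2 * (Φ * A) * (ENNReal.ofReal ((c * r) ^ (-a)) * ENNReal.ofReal ((c * r) ^ κ) *
            ENNReal.ofReal (r ^ (2 * s))) := by ring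
        _ = _ := by
          rw [← ENNReal.ofReal_mul (by positivity), ← ENNReal.ofReal_mul (by positivity), e5,
            ENNReal.ofReal_mul (by positivity), mul_assoc _ (ENNReal.ofReal _)]
    have e6 : ENNReal.ofReal ((c * r) ^ (-a)) * ENNReal.ofReal (2 * (c / (1 - c)) ^ 3) ≤
        2⁻¹ * ENNReal.ofReal (r ^ (-a)) := by
      rw [show (2⁻¹ : ℝ≥0∞) = ENNReal.ofReal (1 / 2) by
          rw [one_div, ENNReal.ofReal_inv_of_pos (by norm_num)]; norm_num,
        ← ENNReal.ofReal_mul (by positivity), ← ENNReal.ofReal_mul (by positivity), e3]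
      refine ENNReal.ofReal_le_ofReal ?_
      have : 0 ≤ r ^ (-a) := by positivity
      nlinarith
    calc b (n + 1) = ENNReal.ofReal ((c * r) ^ (-a)) * T (c * r) := by rw [hb]; simp only [hcr]
      _ ≤ ENNReal.ofReal ((c * r) ^ (-a)) * (2 * (Φ * ENNReal.ofReal ((c * r) ^ κ) *
            (A * ENNReal.ofReal (r ^ (2 * s)))) +
            ENNReal.ofReal (2 * (c / (1 - c)) ^ 3) * T r) := by gcongr
      _ = 2 * (Φ * A) * ENNReal.ofReal (c ^ (κ - a)) * ENNReal.ofReal θ ^ n +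
            ENNReal.ofReal ((c * r) ^ (-a)) * ENNReal.ofReal (2 * (c / (1 - c)) ^ 3) * T r := by
          rw [mul_add, e4, mul_assoc (ENNReal.ofReal ((c * r) ^ (-a)))]
      _ ≤ _ := by
          rw [hb]
          simp only [← mul_assoc]
          gcongr
  calc kernelForm (nearKernel a) F (fun v => ‖G v‖ₑ ^ 2)
      ≤ kernelForm (fun x => ∑' n : ℕ, ENNReal.ofReal ((c ^ (n + 1)) ^ (-a)) *
          ballKernel (c ^ n) x) F (fun v => ‖G v‖ₑ ^ 2) :=
        kernelForm_mono (nearKernel_le_tsum ha0 hc0 hc1)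
    _ = ∑' n : ℕ, ENNReal.ofReal ((c ^ (n + 1)) ^ (-a)) * T (c ^ n) :=
        kernelForm_tsum (fun n => measurable_ballKernel _) hF hg _
    _ = ENNReal.ofReal (c ^ (-a)) * ∑' n, b n := by
        rw [← ENNReal.tsum_mul_left]
        refine tsum_congr fun n => ?_
        rw [hb, ← mul_assoc, ← ENNReal.ofReal_mul (by positivity),
          ← Real.mul_rpow hc0.le (by positivity), pow_succ, mul_comm c]
    _ ≤ ENNReal.ofReal (c ^ (-a)) * (2 * (Φ * A +
          2 * (Φ * A) * ENNReal.ofReal (c ^ (κ - a)) * S)) := by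
        gcongr
        refine (ENNReal.tsum_le_of_contraction hstep).trans ?_
        rw [ENNReal.tsum_mul_left, ENNReal.tsum_geometric]
        gcongr
    _ = _ := by ring

/-! ### Weights and the decomposition of the kernel -/

theorem one_le_bracket (v : E3) : 1 ≤ bracket v :=
  Real.one_le_sqrt.2 (by linarith [sq_nonneg ‖v‖])

theorem bracket_pos (v : E3) : 0 < bracket v := one_pos.trans_le (one_le_bracket v)

theorem norm_le_bracket (v : E3) : ‖v‖ ≤ bracket v :=
  Real.le_sqrt_of_sq_le (by linarith)

theorem bracket_neg (v : E3) : bracket (-v) = bracket v := by simp [bracket]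

theorem bracket_le_two_mul_norm {v : E3} (h : 1 ≤ ‖v‖) : bracket v ≤ 2 * ‖v‖ :=
  Real.sqrt_le_iff.2 ⟨by positivity, by nlinarith⟩

theorem bracket_le_add_norm_sub (v w : E3) : bracket w ≤ bracket v + ‖v - w‖ := by
  have h1 : ‖w‖ ≤ ‖v‖ + ‖v - w‖ := by
    calc ‖w‖ = ‖v - (v - w)‖ := by congr 1; abel
      _ ≤ _ := norm_sub_le _ _
  have h2 := norm_le_bracket v
  have h3 : bracket v ^ 2 = 1 + ‖v‖ ^ 2 := Real.sq_sqrt (by positivity)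
  have h4 := norm_nonneg (v - w)
  have h5 := norm_nonneg w
  refine Real.sqrt_le_iff.2 ⟨by linarith [bracket_pos v], ?_⟩
  nlinarith [norm_nonneg v]

theorem continuous_bracket : Continuous bracket := by
  unfold bracket; fun_prop

/-- The weight `⟨v⟩ ^ t` as an extended nonnegative real. -/
noncomputable def weight (t : ℝ) (v : E3) : ℝ≥0∞ := ENNReal.ofReal (bracket v ^ t)

theorem continuous_bracket_rpow (t : ℝ) : Continuous fun v => bracket v ^ t :=
  continuous_bracket.rpow_const fun v => Or.inl (bracket_pos v).ne'

theorem measurable_weight (t : ℝ) : Measurable (weight t) :=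
  (continuous_bracket_rpow t).measurable.ennreal_ofReal

theorem enorm_bracket_rpow_mul (t : ℝ) (v : E3) (x : ℝ) :
    ‖bracket v ^ t * x‖ₑ = weight t v * ‖x‖ₑ := by
  rw [enorm_mul, weight, Real.enorm_of_nonneg (Real.rpow_nonneg (bracket_pos v).le _)]

theorem enorm_bracket_rpow_half_mul_sq (t : ℝ) (v : E3) (x : ℝ) :
    ‖bracket v ^ (t / 2) * x‖ₑ ^ 2 = weight t v * ‖x‖ₑ ^ 2 := by
  rw [enorm_bracket_rpow_mul, mul_pow, weight, weight,
    ← ENNReal.ofReal_pow (Real.rpow_nonneg (bracket_pos v).le _), ← Real.rpow_natCast,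
    ← Real.rpow_mul (bracket_pos v).le]
  congr 3; push_cast; ring

theorem weight_mul_weight (s t : ℝ) (v : E3) : weight s v * weight t v = weight (s + t) v := by
  rw [weight, weight, weight, ← ENNReal.ofReal_mul (Real.rpow_nonneg (bracket_pos v).le _),
    ← Real.rpow_add (bracket_pos v)]

theorem weight_mono {s t : ℝ} (h : s ≤ t) (v : E3) : weight s v ≤ weight t v :=
  ENNReal.ofReal_le_ofReal (Real.rpow_le_rpow_of_exponent_le (one_le_bracket v) h)

/-- Powers of comparable positive numbers are comparable. -/
theorem rpow_le_two_rpow_mul {x y : ℝ} (hx : 0 < x) (hy : 0 < y) (hxy : x ≤ 2 * y)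
    (hyx : y ≤ 2 * x) (t : ℝ) : x ^ t ≤ 2 ^ |t| * y ^ t := by
  rcases le_total 0 t with h | h
  · rw [abs_of_nonneg h, ← Real.mul_rpow (by norm_num) hy.le]
    exact Real.rpow_le_rpow hx.le hxy h
  · rw [abs_of_nonpos h]
    calc x ^ t ≤ (2⁻¹ * y) ^ t :=
          Real.rpow_le_rpow_of_nonpos (by positivity) (by linarith) h
      _ = 2 ^ (-t) * y ^ t := by
          rw [Real.mul_rpow (by norm_num) hy.le, Real.inv_rpow (by norm_num),
            Real.rpow_neg (by norm_num)]

theorem rpow_le_rpow_neg_mul {x y c t : ℝ} (hx : 0 < x) (hc : 0 < c) (hxy : x ≤ c * y)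
    (ht : t ≤ 0) : y ^ t ≤ c ^ (-t) * x ^ t := by
  have hy : 0 < y := pos_of_mul_pos_right (hx.trans_le hxy) hc.le
  calc y ^ t = c ^ (-t) * (c * y) ^ t := by
        rw [Real.mul_rpow hc.le hy.le, ← mul_assoc, ← Real.rpow_add hc]; simp
    _ ≤ c ^ (-t) * x ^ t := by
        gcongr ?_ * ?_
        exact Real.rpow_le_rpow_of_nonpos hx hxy ht

section
variable {α β ℓ q : ℝ}

/-- For `|v - w| ≤ max(1, ⟨v⟩/2)` the weights at `v` and at `w` are comparable. -/
theorem bracket_rpow_le_of_near {v w : E3}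
    (h : ‖v - w‖ ≤ 1 ∨ ‖v - w‖ ≤ bracket v / 2) :
    bracket w ^ ℓ ≤ 2 ^ |α - β| * (bracket w ^ (-α + β + ℓ) * bracket v ^ (α - β)) := by
  have hv := bracket_pos v
  have hw := bracket_pos w
  have h1 := bracket_le_add_norm_sub v w
  have h2 := bracket_le_add_norm_sub w v
  rw [norm_sub_rev] at h2
  have hv1 := one_le_bracket v
  have hw1 := one_le_bracket w
  have h3 : bracket w ≤ 2 * bracket v := by rcases h with h | h <;> linarith
  have h4 : bracket v ≤ 2 * bracket w := by rcases h with h | h <;> linarith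
  have h5 := rpow_le_two_rpow_mul hw hv h3 h4 (α - β)
  have h6 : bracket w ^ ℓ = bracket w ^ (-α + β + ℓ) * bracket w ^ (α - β) := by
    rw [← Real.rpow_add hw]; congr 1; ring
  rw [h6]
  calc _ ≤ bracket w ^ (-α + β + ℓ) * (2 ^ |α - β| * bracket v ^ (α - β)) := by gcongr
    _ = _ := by ring

/-- For `|v - w| ≤ 1` the singularity of the kernel is kept. -/
theorem kernel_le_near (hℓ : 0 ≤ ℓ) {v w : E3} (h : ‖v - w‖ ≤ 1) :
    ENNReal.ofReal (‖v - w‖ ^ α) ≤ ENNReal.ofReal (2 ^ |α - β|) *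
      (nearKernel (-α) (v - w) * weight (-α + β + ℓ) w * weight (α - β) v) := by
  rw [nearKernel, ballKernel_of_le h, neg_neg, mul_one, weight, weight,
    mul_assoc (ENNReal.ofReal _), ← ENNReal.ofReal_mul (by have := bracket_pos w; positivity),
    mul_left_comm, ← ENNReal.ofReal_mul (by positivity)]
  refine le_mul_of_one_le_right (by positivity) ?_
  rw [ENNReal.one_le_ofReal]
  exact (Real.one_le_rpow (one_le_bracket w) hℓ).trans (bracket_rpow_le_of_near (Or.inl h))

/-- For `1 ≤ |v - w| ≤ ⟨v⟩/2` one has `|v - w| ≲ ⟨w⟩`, and the factor `⟨w⟩^{-ℓ}` improves the decay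
of the kernel to `⟨v - w⟩^{α - ℓ}`. -/
theorem kernel_le_mid (hα : α < 0) (hℓ : 0 ≤ ℓ) (hq : q ≤ ℓ - α) {v w : E3} (h1 : 1 ≤ ‖v - w‖)
    (h : ‖v - w‖ ≤ bracket v / 2) :
    ENNReal.ofReal (‖v - w‖ ^ α) ≤ ENNReal.ofReal (2 ^ (-α) * 2 ^ ℓ * 2 ^ |α - β|) *
      (weight (-q) (v - w) * weight (-α + β + ℓ) w * weight (α - β) v) := by
  have hx0 : 0 < ‖v - w‖ := by linarith
  have hw := bracket_pos w
  have hv := bracket_pos v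
  have hx := bracket_pos (v - w)
  have e1 := bracket_rpow_le_of_near (α := α) (β := β) (ℓ := ℓ) (Or.inr h)
  have e2 : ‖v - w‖ ^ α ≤ 2 ^ (-α) * bracket (v - w) ^ α :=
    rpow_le_rpow_neg_mul hx two_pos (bracket_le_two_mul_norm h1) hα.le
  have e3 : bracket (v - w) ^ α ≤ bracket (v - w) ^ (-q) * bracket (v - w) ^ ℓ := by
    rw [← Real.rpow_add hx]
    exact Real.rpow_le_rpow_of_exponent_le (one_le_bracket _) (by linarith)
  have e4 : bracket (v - w) ^ ℓ ≤ 2 ^ ℓ * bracket w ^ ℓ := by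
    rw [← Real.mul_rpow (by norm_num) hw.le]
    refine Real.rpow_le_rpow hx.le ?_ hℓ
    have := bracket_le_add_norm_sub w v
    rw [norm_sub_rev] at this
    linarith [bracket_le_two_mul_norm h1]
  rw [weight, weight, weight, mul_assoc (ENNReal.ofReal (bracket (v - w) ^ (-q))),
    ← ENNReal.ofReal_mul (by positivity), ← ENNReal.ofReal_mul (by positivity),
    ← ENNReal.ofReal_mul (by positivity)]
  refine ENNReal.ofReal_le_ofReal ?_
  calc ‖v - w‖ ^ α ≤ 2 ^ (-α) * (bracket (v - w) ^ (-q) * (2 ^ ℓ * (2 ^ |α - β| *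
        (bracket w ^ (-α + β + ℓ) * bracket v ^ (α - β))))) := by
        refine e2.trans ?_
        gcongr ?_ * ?_
        refine e3.trans ?_
        gcongr ?_ * ?_
        refine e4.trans ?_
        gcongr ?_ * ?_
    _ = _ := by ring

/-- For `|v - w| ≥ ⟨v⟩/2` both `⟨v⟩` and `⟨w⟩` are `≲ |v - w|`, so the negative power
`|v - w|^α` may be shared out between them. The exponent `max(α, min(β, 0))` given to `⟨w⟩` is the
lowest one for which the rest `⟨v⟩^α` or `⟨v⟩^{α - β}` is a weight under which `ψ²` is
integrable. -/
theorem kernel_le_far (hα : α < 0) (hq : q + max α (min β 0) ≤ -α + β + ℓ) {v w : E3}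
    (h : bracket v / 2 ≤ ‖v - w‖) :
    ENNReal.ofReal (‖v - w‖ ^ α) ≤ ENNReal.ofReal (2 ^ (-α) + 2 ^ (-(α - β)) * 3 ^ (-β) +
        3 ^ (-α)) *
      (weight (-q) w * weight (-α + β + ℓ) w * (weight α v + weight (α - β) v)) := by
  have hw := bracket_pos w
  have hv := bracket_pos v
  have hx0 : 0 < ‖v - w‖ := by linarith
  have e1 : bracket v ≤ 2 * ‖v - w‖ := by linarith
  have e2 : bracket w ≤ 3 * ‖v - w‖ := by linarith [bracket_le_add_norm_sub v w]
  rw [weight_mul_weight]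
  set p := -q + (-α + β + ℓ) with hp
  have hE : weight (max α (min β 0)) w * (weight α v + weight (α - β) v) ≤
      weight p w * (weight α v + weight (α - β) v) := by
    gcongr
    exact weight_mono (by linarith) w
  refine le_trans ?_ (mul_le_mul_right hE _)
  rw [weight, weight, weight, ← ENNReal.ofReal_add (by positivity) (by positivity),
    ← ENNReal.ofReal_mul (by positivity), ← ENNReal.ofReal_mul (by positivity)]
  refine ENNReal.ofReal_le_ofReal ?_
  have p1 : (0 : ℝ) < 2 ^ (-α) := by positivity
  have p2 : (0 : ℝ) < 2 ^ (-(α - β)) * 3 ^ (-β) := by positivity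
  have p3 : (0 : ℝ) < 3 ^ (-α) := by positivity
  -- If `β ≥ 0`, all of the decay goes to `⟨v⟩`.
  rcases le_or_gt 0 β with hβ | hβ
  · rw [min_eq_right hβ, max_eq_right hα.le, Real.rpow_zero, one_mul]
    calc ‖v - w‖ ^ α ≤ 2 ^ (-α) * bracket v ^ α := rpow_le_rpow_neg_mul hv two_pos e1 hα.le
      _ ≤ _ := by
        gcongr ?_ * ?_
        · linarith
        · linarith [Real.rpow_nonneg hv.le (α - β)]
  rw [min_eq_left hβ.le]
  -- If `α ≤ β < 0`, the decay is shared as `⟨v⟩^{α - β} ⟨w⟩^β`.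
  rcases le_or_gt α β with hab | hab
  · rw [max_eq_right hab]
    calc ‖v - w‖ ^ α = ‖v - w‖ ^ (α - β) * ‖v - w‖ ^ β := by
          rw [← Real.rpow_add hx0]; congr 1; ring
      _ ≤ (2 ^ (-(α - β)) * bracket v ^ (α - β)) * (3 ^ (-β) * bracket w ^ β) := by
          gcongr ?_ * ?_
          · exact rpow_le_rpow_neg_mul hv two_pos e1 (by linarith)
          · exact rpow_le_rpow_neg_mul hw three_pos e2 hβ.le
      _ = (2 ^ (-(α - β)) * 3 ^ (-β)) * (bracket w ^ β * bracket v ^ (α - β)) := by ring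
      _ ≤ _ := by
        gcongr ?_ * (_ * ?_)
        · linarith
        · linarith [Real.rpow_nonneg hv.le α]
  -- If `β < α`, all of it goes to `⟨w⟩`, and `⟨v⟩^{α - β} ≥ 1`.
  · rw [max_eq_left hab.le]
    calc ‖v - w‖ ^ α ≤ 3 ^ (-α) * (bracket w ^ α * 1) := by
          rw [mul_one]
          exact rpow_le_rpow_neg_mul hw three_pos e2 hα.le
      _ ≤ _ := by
        gcongr ?_ * (_ * ?_)
        · linarith
        · linarith [Real.rpow_nonneg hv.le α,
            Real.one_le_rpow (one_le_bracket v) (show 0 ≤ α - β by linarith)]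

/-- The kernel `|v - w|^α` is split according to `|v - w| ≤ 1`, `1 < |v - w| ≤ ⟨v⟩/2` and
`|v - w| > max(1, ⟨v⟩/2)`, with the weights carried by `χ` and `ψ` put in. -/
theorem exists_kernel_le (hα : α < 0) (hℓ : 0 ≤ ℓ) (hq : q ≤ ℓ - α)
    (hq' : q + max α (min β 0) ≤ -α + β + ℓ) :
    ∃ C : ℝ≥0∞, C ≠ ⊤ ∧ ∀ v w : E3, ENNReal.ofReal (‖v - w‖ ^ α) ≤
      C * (nearKernel (-α) (v - w) * weight (-α + β + ℓ) w * weight (α - β) v +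
        weight (-q) (v - w) * weight (-α + β + ℓ) w * weight (α - β) v +
        weight (-q) w * weight (-α + β + ℓ) w * (weight α v + weight (α - β) v)) := by
  refine ⟨ENNReal.ofReal (2 ^ |α - β|) + ENNReal.ofReal (2 ^ (-α) * 2 ^ ℓ * 2 ^ |α - β|) +
    ENNReal.ofReal (2 ^ (-α) + 2 ^ (-(α - β)) * 3 ^ (-β) + 3 ^ (-α)), by finiteness, ?_⟩
  intro v w
  rcases le_or_gt ‖v - w‖ 1 with h1 | h1
  · refine (kernel_le_near (β := β) hℓ h1).trans (mul_le_mul' ?_ ?_) <;>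
      exact le_add_right le_self_add
  rcases le_total ‖v - w‖ (bracket v / 2) with h2 | h2
  · refine (kernel_le_mid (β := β) hα hℓ hq h1.le h2).trans (mul_le_mul' ?_ ?_) <;>
      exact le_add_right le_add_self
  · exact (kernel_le_far hα hq' h2).trans (mul_le_mul' le_add_self le_add_self)

/-- The bilinear estimate for `α < 0`, with the integrability of `χ` entering only through the
mass of `⟨·⟩^p |χ|` in small balls and through its convolution with `⟨·⟩^{-q}`. -/
theorem exists_kernelForm_le {s κ : ℝ} (hα : α < 0) (hα3 : -3 < α) (hs : 0 < s)
    (hℓ : 0 ≤ ℓ) (hκ : -α < κ + 2 * s) (hq : q ≤ ℓ - α)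
    (hq' : q + max α (min β 0) ≤ -α + β + ℓ) :
    ∃ C : ℝ≥0∞, C ≠ ⊤ ∧ ∀ (χ ψ : E3 → ℝ) (Φ A : ℝ≥0∞), Measurable χ → Measurable ψ →
      (∀ r : ℝ, 0 < r → r ≤ 1 → ∀ v,
        ∫⁻ w, ‖bracket w ^ (-α + β + ℓ) * χ w‖ₑ * ballKernel r (v - w) ≤
          Φ * ENNReal.ofReal (r ^ κ)) →
      (∀ v, ∫⁻ w, ‖bracket w ^ (-α + β + ℓ) * χ w‖ₑ * weight (-q) (v - w) ≤ Φ) →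
      (∀ h : E3, ∫⁻ v, ‖bracket (v + h) ^ ((α - β) / 2) * ψ (v + h) -
        bracket v ^ ((α - β) / 2) * ψ v‖ₑ ^ 2 ≤ A * ENNReal.ofReal (‖h‖ ^ (2 * s))) →
      ∫⁻ v, ‖bracket v ^ ((α - β) / 2) * ψ v‖ₑ ^ 2 ≤ A →
      ∫⁻ v, ‖bracket v ^ (α / 2) * ψ v‖ₑ ^ 2 ≤ A →
      kernelForm (fun x => ENNReal.ofReal (‖x‖ ^ α)) (fun w => ‖χ w‖ₑ) (fun v => ‖ψ v‖ₑ ^ 2) ≤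
        C * (Φ * A) := by
  obtain ⟨C₁, hC₁, H₁⟩ := exists_kernel_le hα hℓ hq hq'
  obtain ⟨C₂, hC₂, H₂⟩ := exists_kernelForm_nearKernel_le (a := -α) (by linarith) (by linarith)
    hs hκ
  refine ⟨C₁ * (C₂ + 3), by finiteness, ?_⟩
  intro χ ψ Φ A hχ hψ hΦ hΦ' hA hA₁ hA₂
  have hb : ∀ t : ℝ, Measurable fun v => bracket v ^ t := fun t =>
    (continuous_bracket_rpow t).measurable
  set F : E3 → ℝ≥0∞ := fun w => ‖bracket w ^ (-α + β + ℓ) * χ w‖ₑ with hF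
  set G : E3 → ℝ := fun v => bracket v ^ ((α - β) / 2) * ψ v with hG
  set H : E3 → ℝ := fun v => bracket v ^ (α / 2) * ψ v with hH
  have mF : Measurable F := ((hb _).mul hχ).enorm
  have mG : Measurable G := (hb _).mul hψ
  have mH : Measurable H := (hb _).mul hψ
  have mW := measurable_weight (-q)
  have mN := measurable_nearKernel (-α)
  have hpt : ∀ w v, ‖χ w‖ₑ * ENNReal.ofReal (‖v - w‖ ^ α) * ‖ψ v‖ₑ ^ 2 ≤
      C₁ * (F w * nearKernel (-α) (v - w) * ‖G v‖ₑ ^ 2 +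
        F w * weight (-q) (v - w) * ‖G v‖ₑ ^ 2 +
        F w * weight (-q) w * (‖H v‖ₑ ^ 2 + ‖G v‖ₑ ^ 2)) := by
    intro w v
    simp only [hF, hG, hH, enorm_bracket_rpow_half_mul_sq]
    simp only [enorm_bracket_rpow_mul]
    calc _ ≤ ‖χ w‖ₑ * (C₁ * (nearKernel (-α) (v - w) * weight (-α + β + ℓ) w * weight (α - β) v +
        weight (-q) (v - w) * weight (-α + β + ℓ) w * weight (α - β) v +
        weight (-q) w * weight (-α + β + ℓ) w * (weight α v + weight (α - β) v))) *
          ‖ψ v‖ₑ ^ 2 := by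
          gcongr; exact H₁ v w
      _ = _ := by ring
  have near : kernelForm (nearKernel (-α)) F (fun v => ‖G v‖ₑ ^ 2) ≤ C₂ * (Φ * A) :=
    H₂ F G Φ A mF mG hΦ hA hA₁
  have mid : kernelForm (weight (-q)) F (fun v => ‖G v‖ₑ ^ 2) ≤ Φ * A :=
    (kernelForm_le_of_forall_le mW mF (by fun_prop) hΦ').trans (by gcongr)
  have far : ∫⁻ w, ∫⁻ v, F w * weight (-q) w * (‖H v‖ₑ ^ 2 + ‖G v‖ₑ ^ 2) ≤ Φ * (2 * A) := by
    have h0 : ∫⁻ w, F w * weight (-q) w ≤ Φ := by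
      refine le_trans (le_of_eq ?_) (hΦ' 0)
      refine lintegral_congr fun w => ?_
      rw [zero_sub, weight, weight, bracket_neg]
    have h1 : ∫⁻ v, (‖H v‖ₑ ^ 2 + ‖G v‖ₑ ^ 2) ≤ 2 * A := by
      rw [lintegral_add_left (by fun_prop), two_mul]
      gcongr
    calc _ = ∫⁻ w, F w * weight (-q) w * ∫⁻ v, (‖H v‖ₑ ^ 2 + ‖G v‖ₑ ^ 2) := by
          refine lintegral_congr fun w => lintegral_const_mul _ (by fun_prop)
      _ = (∫⁻ w, F w * weight (-q) w) * ∫⁻ v, (‖H v‖ₑ ^ 2 + ‖G v‖ₑ ^ 2) :=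
          lintegral_mul_const _ (by fun_prop)
      _ ≤ _ := by gcongr
  have m1 : Measurable fun w => ∫⁻ v, F w * nearKernel (-α) (v - w) * ‖G v‖ₑ ^ 2 :=
    Measurable.lintegral_prod_right'
      (f := fun p : E3 × E3 => F p.1 * nearKernel (-α) (p.2 - p.1) * ‖G p.2‖ₑ ^ 2) (by fun_prop)
  have m2 : Measurable fun w => ∫⁻ v, F w * weight (-q) (v - w) * ‖G v‖ₑ ^ 2 :=
    Measurable.lintegral_prod_right'
      (f := fun p : E3 × E3 => F p.1 * weight (-q) (p.2 - p.1) * ‖G p.2‖ₑ ^ 2) (by fun_prop)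
  have m12 : Measurable fun w => (∫⁻ v, F w * nearKernel (-α) (v - w) * ‖G v‖ₑ ^ 2) +
      ∫⁻ v, F w * weight (-q) (v - w) * ‖G v‖ₑ ^ 2 := m1.add m2
  calc _ ≤ ∫⁻ w, ∫⁻ v, C₁ * (F w * nearKernel (-α) (v - w) * ‖G v‖ₑ ^ 2 +
        F w * weight (-q) (v - w) * ‖G v‖ₑ ^ 2 +
        F w * weight (-q) w * (‖H v‖ₑ ^ 2 + ‖G v‖ₑ ^ 2)) := by
        unfold kernelForm
        exact lintegral_mono fun w => lintegral_mono fun v => hpt w v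
    _ = C₁ * (kernelForm (nearKernel (-α)) F (fun v => ‖G v‖ₑ ^ 2) +
          kernelForm (weight (-q)) F (fun v => ‖G v‖ₑ ^ 2) +
          ∫⁻ w, ∫⁻ v, F w * weight (-q) w * (‖H v‖ₑ ^ 2 + ‖G v‖ₑ ^ 2)) := by
        unfold kernelForm
        rw [← lintegral_add_left m1, ← lintegral_add_left m12,
          ← lintegral_const_mul' _ _ hC₁]
        refine lintegral_congr fun w => ?_
        rw [lintegral_const_mul' _ _ hC₁, lintegral_add_left (by fun_prop),
          lintegral_add_left (by fun_prop)]
    _ ≤ C₁ * (C₂ * (Φ * A) + Φ * A + Φ * (2 * A)) := by gcongr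
    _ = _ := by ring

end

/-! ### Cauchy–Schwarz bounds for `L²` densities -/

/-- The Cauchy–Schwarz inequality against a nonnegative kernel. -/
theorem lintegral_enorm_mul_le_eLpNorm_two {f : E3 → ℝ} {k : E3 → ℝ≥0∞} (hf : Measurable f)
    (hk : Measurable k) (v : E3) :
    ∫⁻ w, ‖f w‖ₑ * k (v - w) ≤
      eLpNorm f 2 volume * (∫⁻ x, k x ^ (2 : ℝ)) ^ (1 / 2 : ℝ) := by
  have h := ENNReal.lintegral_mul_le_Lp_mul_Lq volume Real.HolderConjugate.two_two
    (f := fun w => ‖f w‖ₑ) (g := fun w => k (v - w)) (by fun_prop) (by fun_prop)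
  refine h.trans (le_of_eq ?_)
  rw [lintegral_sub_left_eq_self (fun x => k x ^ (2 : ℝ)) v]
  congr 1
  rw [eLpNorm_eq_lintegral_rpow_enorm_toReal two_ne_zero ENNReal.ofNat_ne_top]
  simp

theorem lintegral_ballKernel_sq {r : ℝ} (hr : 0 < r) :
    (∫⁻ x, ballKernel r x ^ (2 : ℝ)) ^ (1 / 2 : ℝ) =
      volume (Metric.ball (0 : E3) 1) ^ (1 / 2 : ℝ) * ENNReal.ofReal (r ^ (3 / 2 : ℝ)) := by
  have h1 : ∀ x, ballKernel r x ^ (2 : ℝ) = ballKernel r x := by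
    intro x
    rcases le_or_gt ‖x‖ r with h | h
    · simp [ballKernel_of_le h]
    · simp [ballKernel_of_lt h]
  have h2 := lintegral_ballKernel_sub r 0
  simp only [sub_zero] at h2
  simp_rw [h1]
  rw [h2, volume_closedBall_E3 hr.le, ENNReal.mul_rpow_of_nonneg _ _ (by norm_num),
    ENNReal.ofReal_rpow_of_nonneg (by positivity) (by norm_num), mul_comm,
    ← Real.rpow_natCast, ← Real.rpow_mul hr.le]
  norm_num

theorem lintegral_weight_lt_top {t : ℝ} (ht : 3 < t) : ∫⁻ v, weight (-t) v < ⊤ := by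
  have h := integrable_rpow_neg_one_add_norm_sq (E := E3) (μ := volume) (r := t)
    (by simpa using ht)
  have h2 : ∀ v : E3, bracket v ^ (-t) = (1 + ‖v‖ ^ 2) ^ (-t / 2) := by
    intro v
    rw [bracket, Real.sqrt_eq_rpow, ← Real.rpow_mul (by positivity)]
    congr 1; ring
  unfold weight
  simp_rw [h2]
  exact h.lintegral_lt_top

theorem lintegral_weight_sq_ne_top {q : ℝ} (hq : 3 / 2 < q) :
    (∫⁻ x, weight (-q) x ^ (2 : ℝ)) ^ (1 / 2 : ℝ) ≠ ⊤ := by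
  have h1 : ∀ x, weight (-q) x ^ (2 : ℝ) = weight (-(2 * q)) x := by
    intro x
    rw [ENNReal.rpow_two, sq, weight_mul_weight]
    congr 1; ring
  simp_rw [h1]
  exact ENNReal.rpow_ne_top_of_nonneg (by norm_num) (lintegral_weight_lt_top (by linarith)).ne

/-! ### Almost everywhere convergence of the convolution -/

theorem lintegral_nearKernel_lt_top {α : ℝ} (hα : -3 < α) :
    ∫⁻ x, nearKernel (-α) x < ⊤ := by
  have h : IntegrableOn (fun x : E3 => ‖x‖ ^ α) (Metric.ball 0 2) volume := by
    refine integrableOn_ball_of_norm_le_rpow (C := 1) (α := -α) (by simp) (by simp; linarith)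
      (Filter.Eventually.of_forall fun x => ?_)
      (by fun_prop : Measurable fun x : E3 => ‖x‖ ^ α).aestronglyMeasurable
    rw [neg_neg, one_mul, Real.norm_of_nonneg (by positivity)]
  refine lt_of_le_of_lt ?_ h.lintegral_lt_top
  rw [← lintegral_indicator Metric.isOpen_ball.measurableSet]
  refine lintegral_mono fun x => ?_
  rw [nearKernel, neg_neg]
  rcases le_or_gt ‖x‖ 1 with h | h
  · rw [ballKernel_of_le h, mul_one,
      Set.indicator_of_mem (mem_ball_zero_iff.2 (by linarith))]
  · simp [ballKernel_of_lt h]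

theorem norm_sub_le_bracket_mul (v w : E3) : ‖v - w‖ ≤ 2 * (bracket v * bracket w) := by
  have h1 := one_le_bracket v
  have h2 := one_le_bracket w
  have := (norm_sub_le v w).trans (add_le_add (norm_le_bracket v) (norm_le_bracket w))
  nlinarith

theorem kernel_le_weight_of_nonneg {α : ℝ} (hα : 0 ≤ α) (v w : E3) :
    ENNReal.ofReal (‖v - w‖ ^ α) ≤ ENNReal.ofReal (2 ^ α) * weight α v * weight α w := by
  have hv := bracket_pos v
  have hw := bracket_pos w
  rw [weight, weight, ← ENNReal.ofReal_mul (by positivity), ← ENNReal.ofReal_mul (by positivity),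
    mul_assoc, ← Real.mul_rpow hv.le hw.le, ← Real.mul_rpow (by norm_num) (by positivity)]
  exact ENNReal.ofReal_le_ofReal (Real.rpow_le_rpow (norm_nonneg _)
    (norm_sub_le_bracket_mul v w) hα)

/-- For fixed `v` the kernel is bounded by `⟨w⟩^α` away from its singularity. -/
theorem kernel_le_weight (α : ℝ) (v w : E3) :
    ENNReal.ofReal (‖v - w‖ ^ α) ≤ ENNReal.ofReal ((2 * bracket v) ^ |α|) *
      (weight α w * (1 + nearKernel (-α) (v - w))) := by
  have hv := bracket_pos v
  have hw := bracket_pos w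
  have hv1 := one_le_bracket v
  rcases le_or_gt 0 α with hα | hα
  · refine (kernel_le_weight_of_nonneg hα v w).trans ?_
    rw [abs_of_nonneg hα, Real.mul_rpow zero_le_two hv.le, ENNReal.ofReal_mul (by positivity),
      ← weight]
    gcongr
    exact le_mul_of_one_le_right zero_le le_self_add
  rw [abs_of_neg hα]
  have h1 := bracket_le_add_norm_sub v w
  rcases le_or_gt ‖v - w‖ 1 with h | h
  · have h2 := rpow_le_rpow_neg_mul (t := α) hw (c := 2 * bracket v) (y := 1) (by positivity)
      (by linarith) hα.le
    rw [Real.one_rpow, ← ENNReal.one_le_ofReal, ENNReal.ofReal_mul (by positivity),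
      ← weight] at h2
    rw [nearKernel, ballKernel_of_le h, neg_neg, mul_one, ← mul_assoc]
    exact le_trans le_add_self (le_mul_of_one_le_left zero_le h2)
  · have h2 := rpow_le_rpow_neg_mul (t := α) hw (c := 2 * bracket v) (y := ‖v - w‖)
      (by positivity) (by nlinarith) hα.le
    refine (ENNReal.ofReal_le_ofReal h2).trans ?_
    rw [ENNReal.ofReal_mul (by positivity), ← weight]
    gcongr
    exact le_mul_of_one_le_right zero_le le_self_add

/-- The integral defining `c_α[χ]` converges almost everywhere: its singular part is the convolution
of two integrable functions. -/
theorem ae_integrable_kernel_mul {α : ℝ} (hα : -3 < α) {χ : E3 → ℝ} (hχ : Measurable χ)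
    (h : ∫⁻ w, weight α w * ‖χ w‖ₑ < ⊤) :
    ∀ᵐ v : E3, Integrable (fun w : E3 => ‖v - w‖ ^ α * χ w) volume := by
  have mW := measurable_weight α
  have mN := measurable_nearKernel (-α)
  have hfin : ∫⁻ v, ∫⁻ w, weight α w * ‖χ w‖ₑ * nearKernel (-α) (v - w) < ⊤ := by
    rw [lintegral_lintegral_swap
      (Measurable.aemeasurable (by unfold Function.uncurry; fun_prop))]
    have : ∀ w, ∫⁻ v, weight α w * ‖χ w‖ₑ * nearKernel (-α) (v - w) =
        weight α w * ‖χ w‖ₑ * ∫⁻ x, nearKernel (-α) x := by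
      intro w
      rw [lintegral_const_mul _ (by fun_prop), lintegral_sub_right_eq_self]
    simp_rw [this]
    rw [lintegral_mul_const _ (by fun_prop)]
    exact ENNReal.mul_lt_top h (lintegral_nearKernel_lt_top hα)
  have hm : Measurable fun v => ∫⁻ w, weight α w * ‖χ w‖ₑ * nearKernel (-α) (v - w) :=
    Measurable.lintegral_prod_right'
      (f := fun p : E3 × E3 => weight α p.2 * ‖χ p.2‖ₑ * nearKernel (-α) (p.1 - p.2))
      (by fun_prop)
  filter_upwards [ae_lt_top hm hfin.ne] with v hv
  refine ⟨Measurable.aestronglyMeasurable (by fun_prop), ?_⟩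
  rw [hasFiniteIntegral_iff_enorm]
  calc ∫⁻ w, ‖‖v - w‖ ^ α * χ w‖ₑ
      ≤ ∫⁻ w, ENNReal.ofReal ((2 * bracket v) ^ |α|) * (weight α w * ‖χ w‖ₑ +
          weight α w * ‖χ w‖ₑ * nearKernel (-α) (v - w)) := by
        refine lintegral_mono fun w => ?_
        rw [enorm_mul, Real.enorm_of_nonneg (by positivity)]
        calc _ ≤ ENNReal.ofReal ((2 * bracket v) ^ |α|) *
              (weight α w * (1 + nearKernel (-α) (v - w))) * ‖χ w‖ₑ := by
              gcongr; exact kernel_le_weight α v w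
          _ = _ := by ring
    _ = ENNReal.ofReal ((2 * bracket v) ^ |α|) * ((∫⁻ w, weight α w * ‖χ w‖ₑ) +
          ∫⁻ w, weight α w * ‖χ w‖ₑ * nearKernel (-α) (v - w)) := by
        rw [lintegral_const_mul' _ _ ENNReal.ofReal_ne_top, lintegral_add_left (by fun_prop)]
    _ < ⊤ := ENNReal.mul_lt_top ENNReal.ofReal_lt_top (ENNReal.add_lt_top.2 ⟨h, hv⟩)

/-! ### The two integral estimates -/

/-- A bound on the bilinear form of the absolute values gives integrability of `c_α[χ] ψ²` and a
bound on its integral. -/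
theorem integral_cConv_mul_sq_le {α : ℝ} {χ ψ : E3 → ℝ} (hχ : Measurable χ) (hψ : Measurable ψ)
    {M : ℝ≥0∞} (hM : M ≠ ⊤)
    (h : kernelForm (fun x => ENNReal.ofReal (‖x‖ ^ α)) (fun w => ‖χ w‖ₑ)
      (fun v => ‖ψ v‖ₑ ^ 2) ≤ M) :
    Integrable (fun v => cConv α χ v * ψ v ^ 2) volume ∧
      ∫ v, cConv α χ v * ψ v ^ 2 ≤ M.toReal := by
  rw [kernelForm_eq_swap (by fun_prop) (by fun_prop) (by fun_prop)] at h
  have hm : StronglyMeasurable (cConv α χ) :=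
    StronglyMeasurable.integral_prod_right'
      (f := fun p : E3 × E3 => ‖p.1 - p.2‖ ^ α * χ p.2)
      (Measurable.stronglyMeasurable (by fun_prop))
  have hle : ∫⁻ v, ‖cConv α χ v * ψ v ^ 2‖ₑ ≤ M := by
    refine le_trans (lintegral_mono fun v => ?_) h
    rw [enorm_mul, enorm_pow]
    gcongr
    refine (enorm_integral_le_lintegral_enorm _).trans (le_of_eq ?_)
    refine lintegral_congr fun w => ?_
    rw [enorm_mul, Real.enorm_of_nonneg (by positivity), mul_comm]
  have hmm : AEStronglyMeasurable (fun v => cConv α χ v * ψ v ^ 2) volume :=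
    (hm.measurable.mul (hψ.pow_const 2)).aestronglyMeasurable
  refine ⟨⟨hmm, ?_⟩, ?_⟩
  · rw [hasFiniteIntegral_iff_enorm]
    exact hle.trans_lt hM.lt_top
  · calc ∫ v, cConv α χ v * ψ v ^ 2 ≤ ‖∫ v, cConv α χ v * ψ v ^ 2‖ := Real.le_norm_self _
      _ ≤ (∫⁻ v, ENNReal.ofReal ‖cConv α χ v * ψ v ^ 2‖).toReal :=
          norm_integral_le_lintegral_norm _
      _ ≤ M.toReal := by
          refine ENNReal.toReal_mono hM ?_
          simpa only [ofReal_norm] using hle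

theorem aemeasurable_of_bracket_rpow_mul {t : ℝ} {f : E3 → ℝ}
    (h : AEStronglyMeasurable (fun v => bracket v ^ t * f v) volume) :
    AEMeasurable f volume := by
  have h1 : f = fun v => bracket v ^ (-t) * (bracket v ^ t * f v) := by
    ext v
    rw [← mul_assoc, ← Real.rpow_add (bracket_pos v)]
    simp
  rw [h1]
  exact (continuous_bracket_rpow (-t)).measurable.aemeasurable.mul h.aemeasurable

/-- Passage from the estimate for nonnegative integrals of measurable functions to the full
statement for functions that are measurable only up to null sets. -/
theorem exists_integral_cConv_le {α γ δ s : ℝ} {p D : ℝ≥0∞} (hα : -3 < α) (hD : D ≠ ⊤)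
    (hK : ∀ χ ψ : E3 → ℝ, Measurable χ → Measurable ψ →
      MemLp (fun v => bracket v ^ γ * χ v) p volume →
      sobolevNormSq s (fun v => bracket v ^ δ * ψ v) < ⊤ →
      ∫⁻ w, weight α w * ‖χ w‖ₑ < ⊤ ∧
      kernelForm (fun x => ENNReal.ofReal (‖x‖ ^ α)) (fun w => ‖χ w‖ₑ) (fun v => ‖ψ v‖ₑ ^ 2) ≤
        D * (eLpNorm (fun v => bracket v ^ γ * χ v) p volume *
          (sobolevNormSq s (fun v => bracket v ^ δ * ψ v) +
            eLpNorm (fun v => bracket v ^ (α / 2) * ψ v) 2 volume ^ 2))) :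
    ∃ C : ℝ, 0 < C ∧ ∀ χ ψ : E3 → ℝ,
      MemLp (fun v => bracket v ^ γ * χ v) p volume →
      sobolevNormSq s (fun v => bracket v ^ δ * ψ v) < ⊤ →
      MemLp (fun v => bracket v ^ (α / 2) * ψ v) 2 volume →
      (∀ᵐ v : E3, Integrable (fun w : E3 => ‖v - w‖ ^ α * χ w) volume) ∧
      Integrable (fun v => cConv α χ v * ψ v ^ 2) volume ∧
      ∫ v, cConv α χ v * ψ v ^ 2 ≤
        C * (eLpNorm (fun v => bracket v ^ γ * χ v) p volume).toReal *
          ((sobolevNormSq s (fun v => bracket v ^ δ * ψ v)).toReal +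
            (eLpNorm (fun v => bracket v ^ (α / 2) * ψ v) 2 volume).toReal ^ 2) := by
  refine ⟨D.toReal + 1, by positivity, ?_⟩
  intro χ ψ h1 h2 h3
  have mχ : AEMeasurable χ volume := aemeasurable_of_bracket_rpow_mul h1.1
  have mψ : AEMeasurable ψ volume := aemeasurable_of_bracket_rpow_mul h3.1
  obtain ⟨χ', mχ', eχ⟩ := mχ
  obtain ⟨ψ', mψ', eψ⟩ := mψ
  have eχγ : (fun v => bracket v ^ γ * χ v) =ᵐ[volume] fun v => bracket v ^ γ * χ' v := by
    filter_upwards [eχ] with v hv; rw [hv]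
  have eψδ : (fun v => bracket v ^ δ * ψ v) =ᵐ[volume] fun v => bracket v ^ δ * ψ' v := by
    filter_upwards [eψ] with v hv; rw [hv]
  have eψα : (fun v => bracket v ^ (α / 2) * ψ v) =ᵐ[volume]
      fun v => bracket v ^ (α / 2) * ψ' v := by
    filter_upwards [eψ] with v hv; rw [hv]
  have eker : ∀ v : E3, (fun w => ‖v - w‖ ^ α * χ w) =ᵐ[volume]
      fun w => ‖v - w‖ ^ α * χ' w := fun v => by
    filter_upwards [eχ] with w hw; rw [hw]
  have econv : cConv α χ = cConv α χ' := by
    ext v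
    exact integral_congr_ae (eker v)
  have eprod : (fun v => cConv α χ v * ψ v ^ 2) =ᵐ[volume] fun v => cConv α χ' v * ψ' v ^ 2 := by
    filter_upwards [eψ] with v hv; rw [hv, econv]
  rw [sobolevNormSq_congr eψδ] at h2 ⊢
  rw [eLpNorm_congr_ae eχγ, eLpNorm_congr_ae eψα, integrable_congr eprod,
    integral_congr_ae eprod]
  simp_rw [integrable_congr (eker _)]
  replace h1 := (memLp_congr_ae eχγ).1 h1
  replace h3 := (memLp_congr_ae eψα).1 h3
  obtain ⟨hw, hk⟩ := hK χ' ψ' mχ' mψ' h1 h2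
  have n1 := h1.eLpNorm_ne_top
  have n2 := h2.ne
  have n3 := h3.eLpNorm_ne_top
  obtain ⟨i1, i2⟩ := integral_cConv_mul_sq_le mχ' mψ' (by finiteness) hk
  refine ⟨ae_integrable_kernel_mul hα mχ' hw, i1, i2.trans ?_⟩
  rw [ENNReal.toReal_mul, ENNReal.toReal_mul, ENNReal.toReal_add n2 (by finiteness),
    ENNReal.toReal_pow, mul_assoc]
  gcongr
  linarith

/-- The case `α < 0` of both estimates: all that is used of the norm on `χ` is that it controls
the mass of `⟨·⟩^γ |χ|` in small balls and its convolution with `⟨·⟩^{-q}`. -/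
theorem exists_integral_cConv_le_of_neg {α β ℓ s κ q : ℝ} {p D : ℝ≥0∞} (hα : α < 0)
    (hα3 : -3 < α) (hs : 0 < s) (hs1 : s < 1) (hℓ : 0 ≤ ℓ) (hκ : -α < κ + 2 * s)
    (hq : q ≤ ℓ - α) (hq' : q + max α (min β 0) ≤ -α + β + ℓ) (hD : D ≠ ⊤)
    (hball : ∀ f : E3 → ℝ, Measurable f → ∀ r : ℝ, 0 < r → r ≤ 1 → ∀ v,
      ∫⁻ w, ‖f w‖ₑ * ballKernel r (v - w) ≤ D * eLpNorm f p volume * ENNReal.ofReal (r ^ κ))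
    (hweight : ∀ f : E3 → ℝ, Measurable f → ∀ v,
      ∫⁻ w, ‖f w‖ₑ * weight (-q) (v - w) ≤ D * eLpNorm f p volume) :
    ∃ C : ℝ, 0 < C ∧ ∀ χ ψ : E3 → ℝ,
      MemLp (fun v => bracket v ^ (|α| + β + ℓ) * χ v) p volume →
      sobolevNormSq s (fun v => bracket v ^ ((α - β) / 2) * ψ v) < ⊤ →
      MemLp (fun v => bracket v ^ (α / 2) * ψ v) 2 volume →
      (∀ᵐ v : E3, Integrable (fun w : E3 => ‖v - w‖ ^ α * χ w) volume) ∧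
      Integrable (fun v => cConv α χ v * ψ v ^ 2) volume ∧
      ∫ v, cConv α χ v * ψ v ^ 2 ≤
        C * (eLpNorm (fun v => bracket v ^ (|α| + β + ℓ) * χ v) p volume).toReal *
          ((sobolevNormSq s (fun v => bracket v ^ ((α - β) / 2) * ψ v)).toReal +
            (eLpNorm (fun v => bracket v ^ (α / 2) * ψ v) 2 volume).toReal ^ 2) := by
  obtain ⟨C, hC, H⟩ := exists_kernelForm_le hα hα3 hs hℓ hκ hq hq'
  rw [abs_of_neg hα]
  refine exists_integral_cConv_le (D := C * (D * 4)) hα3 (by finiteness) ?_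
  intro χ ψ mχ mψ h1 h2
  have mf : Measurable fun v => bracket v ^ (-α + β + ℓ) * χ v :=
    (continuous_bracket_rpow _).measurable.mul mχ
  set N := eLpNorm (fun v => bracket v ^ (-α + β + ℓ) * χ v) p volume with hN
  set S := sobolevNormSq s (fun v => bracket v ^ ((α - β) / 2) * ψ v) with hS
  set L := eLpNorm (fun v => bracket v ^ (α / 2) * ψ v) 2 volume with hL
  have hG := memLp_of_sobolevNormSq_lt_top h2
  constructor
  · refine lt_of_le_of_lt ?_ (ENNReal.mul_lt_top hD.lt_top h1.eLpNorm_lt_top)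
    refine le_trans (lintegral_mono fun w => ?_) (hweight _ mf 0)
    rw [enorm_bracket_rpow_mul, mul_right_comm, zero_sub]
    gcongr
    rw [show weight (-q) (-w) = weight (-q) w by rw [weight, weight, bracket_neg],
      weight_mul_weight]
    exact weight_mono (by linarith [le_max_left α (min β 0)]) w
  · have hA : S ≤ 4 * S + L ^ 2 :=
      le_add_right (le_mul_of_one_le_left zero_le (by norm_num))
    refine (H χ ψ (D * N) (4 * S + L ^ 2) mχ mψ (hball _ mf) (hweight _ mf) ?_ ?_ ?_).trans ?_
    · intro h
      refine (lintegral_translate_sub_sq_le hs hs1 hG h).trans ?_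
      gcongr
      exact le_self_add
    · exact (lintegral_sq_le_sobolevNormSq hG).trans hA
    · rw [← eLpNorm_two_sq]
      exact le_add_self
    · have : 4 * S + L ^ 2 ≤ 4 * (S + L ^ 2) := by
        rw [mul_add]
        gcongr
        exact le_mul_of_one_le_left zero_le (by norm_num)
      calc C * (D * N * (4 * S + L ^ 2)) ≤ C * (D * N * (4 * (S + L ^ 2))) := by gcongr
        _ = _ := by ring

theorem mainTheorem9 :
    (∀ α s β ℓ : ℝ, -3 < α → α ≤ 1 → 0 < s → s < 1 →
      -(3 / 2) < α + 2 * s → α + 2 * s < 0 →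
      3 / 2 + (α + 2 * s) < ℓ → 3 / 2 < 2 * |α| + β + ℓ →
      ∃ C : ℝ, 0 < C ∧ ∀ χ ψ : E3 → ℝ,
        MemLp (fun v => bracket v ^ (|α| + β + ℓ) * χ v) 2 volume →
        sobolevNormSq s (fun v => bracket v ^ ((α - β) / 2) * ψ v) < ⊤ →
        MemLp (fun v => bracket v ^ (α / 2) * ψ v) 2 volume →
        (∀ᵐ v : E3, Integrable (fun w : E3 => ‖v - w‖ ^ α * χ w) volume) ∧
        Integrable (fun v => cConv α χ v * ψ v ^ 2) volume ∧
        ∫ v, cConv α χ v * ψ v ^ 2 ≤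
          C * (eLpNorm (fun v => bracket v ^ (|α| + β + ℓ) * χ v) 2 volume).toReal *
            ((sobolevNormSq s (fun v => bracket v ^ ((α - β) / 2) * ψ v)).toReal +
              (eLpNorm (fun v => bracket v ^ (α / 2) * ψ v) 2 volume).toReal ^ 2)) ∧
    (∀ α s β : ℝ, -3 < α → α ≤ 1 → 0 < s → s < 1 →
      0 < α + 2 * s → α ≤ |α| + β →
      ∃ C : ℝ, 0 < C ∧ ∀ χ ψ : E3 → ℝ,
        MemLp (fun v => bracket v ^ (|α| + β) * χ v) 1 volume →
        sobolevNormSq s (fun v => bracket v ^ ((α - β) / 2) * ψ v) < ⊤ →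
        MemLp (fun v => bracket v ^ (α / 2) * ψ v) 2 volume →
        (∀ᵐ v : E3, Integrable (fun w : E3 => ‖v - w‖ ^ α * χ w) volume) ∧
        Integrable (fun v => cConv α χ v * ψ v ^ 2) volume ∧
        ∫ v, cConv α χ v * ψ v ^ 2 ≤
          C * (eLpNorm (fun v => bracket v ^ (|α| + β) * χ v) 1 volume).toReal *
            ((sobolevNormSq s (fun v => bracket v ^ ((α - β) / 2) * ψ v)).toReal +
              (eLpNorm (fun v => bracket v ^ (α / 2) * ψ v) 2 volume).toReal ^ 2)) := by
  constructor
  · intro α s β ℓ hα3 _ hs hs1 h1 h2 h3 h4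
    have hα : α < 0 := by linarith
    have hE : max α (min β 0) < -α + β + ℓ - 3 / 2 := by
      rw [abs_of_neg hα] at h4
      refine max_lt (by linarith) ?_
      rcases le_total β 0 with hβ | hβ
      · rw [min_eq_left hβ]; linarith
      · rw [min_eq_right hβ]; linarith
    -- The largest admissible decay; `q > 3/2` makes `⟨·⟩^{-q}` square integrable.
    set q := min (ℓ - α) (-α + β + ℓ - max α (min β 0)) with hq
    have hq32 : 3 / 2 < q := lt_min (by linarith) (by linarith)
    set V := volume (Metric.ball (0 : E3) 1) ^ (1 / 2 : ℝ) with hV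
    have hVt : V ≠ ⊤ := ENNReal.rpow_ne_top_of_nonneg (by norm_num) measure_ball_lt_top.ne
    set W := (∫⁻ x, weight (-q) x ^ (2 : ℝ)) ^ (1 / 2 : ℝ) with hW
    have hWt : W ≠ ⊤ := lintegral_weight_sq_ne_top hq32
    refine exists_integral_cConv_le_of_neg (κ := 3 / 2) (q := q) (D := V + W) hα hα3 hs hs1
      (by linarith) (by linarith) (min_le_left _ _)
      (by linarith [min_le_right (ℓ - α) (-α + β + ℓ - max α (min β 0))]) (by finiteness) ?_ ?_
    · intro f mf r hr _ v
      refine (lintegral_enorm_mul_le_eLpNorm_two mf (measurable_ballKernel r) v).trans ?_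
      rw [lintegral_ballKernel_sq hr, ← mul_assoc, mul_comm (eLpNorm f 2 volume)]
      gcongr
      exact le_self_add
    · intro f mf v
      refine (lintegral_enorm_mul_le_eLpNorm_two mf (measurable_weight _) v).trans ?_
      rw [mul_comm]
      gcongr
      exact le_add_self
  · intro α s β hα3 _ hs hs1 h1 h2
    rcases lt_or_ge α 0 with hα | hα
    · have key := exists_integral_cConv_le_of_neg (α := α) (β := β) (ℓ := 0) (s := s) (κ := 0)
        (q := 0) (p := 1) (D := 1) hα hα3 hs hs1 le_rfl (by linarith) (by linarith) (by
          rw [abs_of_neg hα] at h2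
          rw [zero_add, add_zero]
          refine max_le h2 ((min_le_left _ _).trans (by linarith))) ENNReal.one_ne_top ?_ ?_
      · simpa only [add_zero] using key
      · intro f mf r _ _ v
        rw [Real.rpow_zero, ENNReal.ofReal_one, mul_one, one_mul, eLpNorm_one_eq_lintegral_enorm]
        refine lintegral_mono fun w => mul_le_of_le_one_right zero_le ?_
        rcases le_or_gt ‖v - w‖ r with h | h
        · rw [ballKernel_of_le h]
        · rw [ballKernel_of_lt h]; exact zero_le_one
      · intro f mf v
        rw [one_mul, eLpNorm_one_eq_lintegral_enorm]
        refine lintegral_mono fun w => mul_le_of_le_one_right zero_le ?_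
        simp [weight]
    · refine exists_integral_cConv_le (D := ENNReal.ofReal (2 ^ α)) hα3 ENNReal.ofReal_ne_top ?_
      intro χ ψ mχ mψ hχ _
      have mW := measurable_weight α
      have hw : ∫⁻ w, weight α w * ‖χ w‖ₑ ≤
          eLpNorm (fun v => bracket v ^ (|α| + β) * χ v) 1 volume := by
        rw [eLpNorm_one_eq_lintegral_enorm]
        refine lintegral_mono fun w => ?_
        rw [enorm_bracket_rpow_mul]
        gcongr
        exact weight_mono h2 w
      refine ⟨hw.trans_lt hχ.eLpNorm_lt_top, ?_⟩
      calc kernelForm (fun x => ENNReal.ofReal (‖x‖ ^ α)) (fun w => ‖χ w‖ₑ)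
            (fun v => ‖ψ v‖ₑ ^ 2)
          ≤ ∫⁻ w, ∫⁻ v, ENNReal.ofReal (2 ^ α) *
              (weight α w * ‖χ w‖ₑ * ‖bracket v ^ (α / 2) * ψ v‖ₑ ^ 2) := by
            refine lintegral_mono fun w => lintegral_mono fun v => ?_
            rw [enorm_bracket_rpow_half_mul_sq]
            calc _ ≤ ‖χ w‖ₑ * (ENNReal.ofReal (2 ^ α) * weight α v * weight α w) *
                  ‖ψ v‖ₑ ^ 2 := by
                  gcongr; exact kernel_le_weight_of_nonneg hα v w
              _ = _ := by ring
        _ = ENNReal.ofReal (2 ^ α) * ((∫⁻ w, weight α w * ‖χ w‖ₑ) *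
              eLpNorm (fun v => bracket v ^ (α / 2) * ψ v) 2 volume ^ 2) := by
            have hm : Measurable fun v => bracket v ^ (α / 2) * ψ v :=
              (continuous_bracket_rpow _).measurable.mul mψ
            rw [eLpNorm_two_sq, ← lintegral_mul_const _ (by fun_prop),
              ← lintegral_const_mul _ (by fun_prop)]
            refine lintegral_congr fun w => ?_
            rw [lintegral_const_mul' _ _ ENNReal.ofReal_ne_top, lintegral_const_mul _ (by fun_prop)]
        _ ≤ _ := by
            gcongr
            exact le_add_self
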